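/- Let $d\ge 2$, let $\sigma$ be the surface measure on the unit sphere $\mathbb S^{d-1}\subset\mathbb R^d$, and let all functions be real valued. Let $\operatorname{proj}_n$ be the orthogonal projection of $L^2(\mathbb S^{d-1})$ onto the space $\mathcal H_n^d$ of spherical harmonics of degree $n$ (restrictions to the sphere of homogeneous harmonic polynomials of degree $n$). For $f\in L^2(\mathbb S^{d-1})$, the function $g=(-\Delta_0)^{1/2}f$ is determined by $\operatorname{proj}_0 g=0$ and $\operatorname{proj}_n g=(n(n+d-2))^{1/2}\operatorname{proj}_n f$ for $n\ge 1$; the space $W_2^1(\mathbb S^{d-1})$ consists of the $f\in L^2(\mathbb S^{d-1})$ for which such a $g\in L^2(\mathbb S^{d-1})$ exists. For an integer $k\ge 0$ let $L_k^2(\mathbb S^{d-1})$ be the space of all $f\in L^2(\mathbb S^{d-1})$ with $\int_{\mathbb S^{d-1}} fP\,d\sigma=0$ for all polynomials $P$ of total degree at most $k$. For a real number $C$, consider the inequality $$\int_{\mathbb S^{d-1}}|f|^2\,d\sigma\le C\min_{e\in\mathbb S^{d-1}}\int_{\mathbb S^{d-1}}(1-\langle x,e\rangle)\,|(-\Delta_0)^{1/2}f(x)|^2\,d\sigma(x)\quad\text{for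 all } f\in L_k^2(\mathbb S^{d-1})\cap W_2^1(\mathbb S^{d-1}).\tag{$H_{d,k,C}$}$$ Put $\lambda=\frac{d-2}2$ and define positive numbers $\alpha_n=\alpha_n^\lambda$ ($n\ge 1$) by $$\alpha_{2m+1}^2=\frac{2\,\Gamma(m+\frac32)\,\Gamma(m+1+\lambda)}{(2m+\lambda+1)\,\Gamma(m+1)\,\Gamma(m+\lambda+\frac12)}\ (m\ge 0),\qquad \alpha_{2m}^2=\frac{2\,m!\,\Gamma(m+\lambda+\frac12)}{(2m+\lambda)\,\Gamma(m+\frac12)\,\Gamma(m+\lambda)}\ (m\ge 1),$$ and put $$\beta_\lambda(n)=\Bigl(1-\alpha_n^2+\frac{\alpha_n^2}{8n^2}\Bigr)n(n+2\lambda),\qquad \beta_\lambda(\infty)=\frac{(2\lambda-1)^2}{8}.$$ Let $n(d)$ be the least integer $N\ge 0$ such that $\inf\{\beta_\lambda(n): n\ge 1,\ n\ge N\}=\beta_\lambda(\infty)$. **Theorem.** (i) For every $d\ge 4$ the integer $n(d)$ exists and $n(d)\le 3(d-2)^3/16$. Moreover, for every integer $k\ge n(d)$ (in particular for $k=n(d)$),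 $(H_{d,k,C})$ holds with $C=C_d:=\frac{8}{(d-3)^2}$, and $C_d$ is optimal: it is the least $C$ for which $(H_{d,k,C})$ holds. (ii) The integer $n(2)$ exists, and $n(2)=n(4)=n(5)=0$ and $n(6)=4$. For $d=2$ too, $C_2=8$ is the least $C$ for which $(H_{2,k,C})$ holds, for every integer $k\ge n(2)=0$. (iii) For $d=3$ and every integer $k\ge 0$, $(H_{3,k,C})$ fails for every finite constant $C$. -/

import Mathlib

noncomputable section

namespace HardyRellich

open MeasureTheory MvPolynomial

/-- The unit sphere `S^{d-1}` of `ℝ^d`. -/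
abbrev Sph (d : ℕ) : Type := Metric.sphere (0 : EuclideanSpace ℝ (Fin d)) 1

/-- The usual (unnormalized) rotation-invariant surface measure on `S^{d-1}`. -/
abbrev surf (d : ℕ) : Measure (Sph d) := (volume : Measure (EuclideanSpace ℝ (Fin d))).toSphere

/-- The real Hilbert space `L²(S^{d-1})`. -/
abbrev L2 (d : ℕ) : Type := Lp ℝ 2 (surf d)

/-- The restriction of a polynomial in `d` real variables to the sphere. -/
def restrict (d : ℕ) : MvPolynomial (Fin d) ℝ →ₗ[ℝ] C(Sph d, ℝ) where
  toFun P :=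
    { toFun := fun x => eval (fun i => (x : EuclideanSpace ℝ (Fin d)) i) P
      continuous_toFun :=
        P.continuous_eval.comp (continuous_pi fun i =>
          (EuclideanSpace.proj i : EuclideanSpace ℝ (Fin d) →L[ℝ] ℝ).continuous.comp
            continuous_subtype_val) }
  map_add' P Q := by ext x; simp
  map_smul' c P := by ext x; simp

/-- The Laplace operator on polynomials in `d` variables. -/
def laplacian (d : ℕ) : MvPolynomial (Fin d) ℝ →ₗ[ℝ] MvPolynomial (Fin d) ℝ :=
  ∑ i : Fin d, (pderiv i).toLinearMap ∘ₗ (pderiv i).toLinearMap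

/-- The space of spherical harmonics of degree `n`: restrictions to the sphere of the homogeneous
harmonic polynomials of degree `n`, as a subspace of `L²(S^{d-1})`. -/
def harmonics (d n : ℕ) : Submodule ℝ (L2 d) :=
  (homogeneousSubmodule (Fin d) ℝ n ⊓ LinearMap.ker (laplacian d)).map
    ((ContinuousMap.toLp (E := ℝ) 2 (surf d) ℝ).toLinearMap ∘ₗ restrict d)

instance harmonics_finiteDimensional (d n : ℕ) : FiniteDimensional ℝ (harmonics d n) := by
  have h : FiniteDimensional ℝ (homogeneousSubmodule (Fin d) ℝ n) :=
    Module.Finite.iff_fg.mpr (homogeneousSubmodule_fg _ _ n)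
  have h' : FiniteDimensional ℝ
      ↥(homogeneousSubmodule (Fin d) ℝ n ⊓ LinearMap.ker (laplacian d)) :=
    Submodule.finiteDimensional_inf_left _ _
  unfold harmonics
  infer_instance

/-- The orthogonal projection `proj_n` of `L²(S^{d-1})` onto the spherical harmonics of
degree `n`. -/
def proj (d n : ℕ) : L2 d →L[ℝ] L2 d := (harmonics d n).starProjection

/-- `g ∈ L²` is `(-Δ₀)^r f`: `proj_0 g = 0` and `proj_n g = (n(n+d-2))^r proj_n f` for `n ≥ 1`. -/
def IsFracLaplacian (d : ℕ) (r : ℝ) (f g : L2 d) : Prop :=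
  proj d 0 g = 0 ∧
    ∀ n : ℕ, 1 ≤ n → proj d n g = ((n : ℝ) * ((n : ℝ) + (d : ℝ) - 2)) ^ r • proj d n f

open Classical in
/-- The fractional Laplace-Beltrami operator `(-Δ₀)^r f`, whenever it lies in `L²`. The spherical
harmonics span a dense subspace of `L²`, so that the chosen element is the only one. -/
def fracLaplacian (d : ℕ) (r : ℝ) (f : L2 d) : L2 d :=
  if h : ∃ g, IsFracLaplacian d r f g then h.choose else 0

/-- The Sobolev space `W_2^α(S^{d-1})`: the `f ∈ L²` with `(-Δ₀)^{α/2} f ∈ L²`. -/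
def sobolev (d : ℕ) (α : ℝ) : Set (L2 d) := {f | ∃ g, IsFracLaplacian d (α / 2) f g}

/-- The functions in `L²(S^{d-1})` orthogonal to all spherical polynomials of degree at
most `k`. -/
def orthPoly (d k : ℕ) : Set (L2 d) :=
  {f | ∀ P : MvPolynomial (Fin d) ℝ, P.totalDegree ≤ k → ∫ x, f x * restrict d P x ∂surf d = 0}

/-- `∫ (1 - ⟨x, e⟩) |g(x)|² dσ(x)`. -/
def weightedEnergy (d : ℕ) (g : L2 d) (e : Sph d) : ℝ :=
  ∫ x, (1 - inner ℝ (x : EuclideanSpace ℝ (Fin d)) (e : EuclideanSpace ℝ (Fin d))) * |g x| ^ 2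
    ∂surf d

/-- `min_e ∫ (1 - ⟨x, e⟩) |g(x)|² dσ(x)`; see `minWeightedEnergy_isLeast`. -/
def minWeightedEnergy (d : ℕ) (g : L2 d) : ℝ := ⨅ e : Sph d, weightedEnergy d g e

theorem weightedEnergy_continuous (d : ℕ) (g : L2 d) : Continuous (weightedEnergy d g) := by
  have hg : Integrable (fun x => |g x| ^ 2) (surf d) := by
    simpa using (Lp.memLp g).integrable_sq
  unfold weightedEnergy
  refine continuous_of_dominated (bound := fun x => 2 * |g x| ^ 2) ?_ ?_ (hg.const_mul 2) ?_
  · intro e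
    refine AEStronglyMeasurable.mul ?_ hg.aestronglyMeasurable
    exact Continuous.aestronglyMeasurable (by fun_prop)
  · intro e
    refine Filter.Eventually.of_forall fun x => ?_
    rw [norm_mul, Real.norm_of_nonneg (sq_nonneg |g x|)]
    refine mul_le_mul_of_nonneg_right ?_ (sq_nonneg _)
    have h := abs_real_inner_le_norm (x : EuclideanSpace ℝ (Fin d)) (e : EuclideanSpace ℝ (Fin d))
    have hx : ‖(x : EuclideanSpace ℝ (Fin d))‖ = 1 := by simp
    have he : ‖(e : EuclideanSpace ℝ (Fin d))‖ = 1 := by simp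
    rw [hx, he, mul_one, abs_le] at h
    rw [Real.norm_eq_abs, abs_le]
    constructor <;> linarith [h.1, h.2]
  · exact Filter.Eventually.of_forall fun x => by fun_prop

theorem minWeightedEnergy_isLeast (d : ℕ) (hd : 1 ≤ d) (g : L2 d) :
    IsLeast (Set.range (weightedEnergy d g)) (minWeightedEnergy d g) := by
  have : Nonempty (Fin d) := ⟨⟨0, hd⟩⟩
  have : Nonempty (Sph d) := (NormedSpace.sphere_nonempty.mpr zero_le_one).to_subtype
  have h := (isCompact_range (weightedEnergy_continuous d g)).isLeast_sInf (Set.range_nonempty _)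
  simpa [minWeightedEnergy, iInf] using h

/-- The Hardy-Rellich inequality with constant `C` for all `f ∈ W_2^1(S^{d-1})` orthogonal to the
polynomials of degree at most `k`. -/
def Inequality (d k : ℕ) (C : ℝ) : Prop :=
  ∀ f ∈ orthPoly d k ∩ sobolev d 1,
    ∫ x, |f x| ^ 2 ∂surf d ≤ C * minWeightedEnergy d (fracLaplacian d (1 / 2) f)

/-- The sequence `α_n^λ`, `n ≥ 1`, with separate formulas for even and odd `n`. -/
def alpha (lam : ℝ) (n : ℕ) : ℝ :=
  let m : ℕ := n / 2
  if Even n then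
    √(2 * (m.factorial : ℝ) * Real.Gamma (m + lam + 1 / 2) /
      ((2 * m + lam) * Real.Gamma (m + 1 / 2) * Real.Gamma (m + lam)))
  else
    √(2 * Real.Gamma (m + 3 / 2) * Real.Gamma (m + 1 + lam) /
      ((2 * m + lam + 1) * Real.Gamma (m + 1) * Real.Gamma (m + lam + 1 / 2)))

/-- The sequence `β_λ(n)`, `n ≥ 1`. -/
def beta (lam : ℝ) (n : ℕ) : ℝ :=
  (1 - alpha lam n ^ 2 + alpha lam n ^ 2 / (8 * (n : ℝ) ^ 2)) * ((n : ℝ) * ((n : ℝ) + 2 * lam))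

/-- The limit `β_λ(∞) = (2λ-1)²/8` of `β_λ(n)`. -/
def betaInf (lam : ℝ) : ℝ := (2 * lam - 1) ^ 2 / 8

/-- The integers `N ≥ 0` such that the infimum of `β_λ(n)` over all `n ≥ 1` with `n ≥ N`
is `β_λ(∞)`. -/
def thresholds (lam : ℝ) : Set ℕ :=
  {N | IsGLB (beta lam '' {n : ℕ | 1 ≤ n ∧ N ≤ n}) (betaInf lam)}

/-- The integer `n(d)`: the least element of `thresholds λ` with `λ = (d-2)/2`. -/
def index (d : ℕ) : ℕ := sInf (thresholds (((d : ℝ) - 2) / 2))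

end HardyRellich

end

namespace HardyRellich

open Filter Topology

/-! ### Quotients of Gamma functions -/

/-! Write `g = (-Δ₀)^{1/2} f` and let `f_n`, `g_n` be the components of degree `n`. The weighted
energy is `‖g‖² - ⟨⟨x,e⟩ g, g⟩`. Multiplication by `⟨x,e⟩` couples only consecutive degrees, and its
block from degree `n ≥ 1` to `n + 1` has norm `α_n α_{n+1} / 2` (`norm_sph_raise_sq_le`,
`two_mul_sqrt_coefSq`). With `u_n = α_n ‖g_n‖` the energy is therefore at least `∑ ‖g_n‖² - ∑ u_n
u_{n+1}`, whatever `e` is. The discrete Hardy inequality `∑ u_n u_{n+1} ≤ ∑ (1 - 1/(8n²)) u_n²`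
(`sum_mul_succ_le`) and `‖g_n‖² = n(n+2λ) ‖f_n‖²` turn this into the lower bound `∑ β_λ(n) ‖f_n‖²`
(`sum_beta_mul_le`). If `β_λ(n) ≥ β_λ(∞)` for all `n > k`, the inequality follows with constant
`1/β_λ(∞) = 8/(d-3)²`.

Conversely, zonal harmonics give equality in every block estimate, so the inequality on the sphere
contains a discrete inequality for arbitrary sequences vanishing up to `k` (`exists_zonal_test`).
Truncations of `√n`, the critical sequence for the Hardy inequality, make both sides grow like a
harmonic sum. Comparing coefficients gives `1 ≤ C β_λ(∞)` (`one_le_of_discrete_inequality`). This is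
optimality, and for `d = 3`, where `β_λ(∞) = 0`, it excludes every `C`.

The bounds on `n(d)` come from the sharp estimate `gammaQuot y ^ 2 ≤ y + 1/(32 y)`, which reduces
`β_λ(n) ≥ β_λ(∞)` to a polynomial inequality; for `λ = 0, 1, 2` the numbers `α_n` are explicit. -/

theorem Gamma_midpoint_sq_le {s t : ℝ} (hs : 0 < s) (ht : 0 < t) :
    Real.Gamma ((s + t) / 2) ^ 2 ≤ Real.Gamma s * Real.Gamma t := by
  have h := Real.Gamma_mul_add_mul_le_rpow_Gamma_mul_rpow_Gamma (s := s) (t := t)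
    (a := 1 / 2) (b := 1 / 2) hs ht (by norm_num) (by norm_num) (by norm_num)
  have hG : 0 < Real.Gamma s := Real.Gamma_pos_of_pos hs
  have hG' : 0 < Real.Gamma t := Real.Gamma_pos_of_pos ht
  rw [← Real.sqrt_eq_rpow, ← Real.sqrt_eq_rpow, ← Real.sqrt_mul hG.le] at h
  have h0 : 0 ≤ Real.Gamma ((s + t) / 2) := (Real.Gamma_pos_of_pos (by linarith)).le
  have e : 1 / 2 * s + 1 / 2 * t = (s + t) / 2 := by ring
  rw [e] at h
  calc _ ≤ √(Real.Gamma s * Real.Gamma t) ^ 2 := pow_le_pow_left₀ h0 h 2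
    _ = _ := Real.sq_sqrt (mul_pos hG hG').le

/-- The quotient `Γ(y + 3/4) / Γ(y + 1/4)`. -/
noncomputable def gammaQuot (y : ℝ) : ℝ := Real.Gamma (y + 3 / 4) / Real.Gamma (y + 1 / 4)

theorem gammaQuot_pos {y : ℝ} (hy : -(1 / 4) < y) : 0 < gammaQuot y :=
  div_pos (Real.Gamma_pos_of_pos (by linarith)) (Real.Gamma_pos_of_pos (by linarith))

theorem gammaQuot_mul_shift {y : ℝ} (hy : -(1 / 4) < y) :
    gammaQuot y * gammaQuot (y + 1 / 2) = y + 1 / 4 := by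
  have h1 : Real.Gamma (y + 1 / 4) ≠ 0 := (Real.Gamma_pos_of_pos (by linarith)).ne'
  have h2 : Real.Gamma (y + 3 / 4) ≠ 0 := (Real.Gamma_pos_of_pos (by linarith)).ne'
  have h3 := Real.Gamma_add_one (s := y + 1 / 4) (by linarith)
  have e1 : y + 1 / 2 + 3 / 4 = y + 1 / 4 + 1 := by ring
  have e2 : y + 1 / 2 + 1 / 4 = y + 3 / 4 := by ring
  rw [gammaQuot, gammaQuot, e1, e2, h3, div_mul_div_comm, div_eq_iff (mul_ne_zero h1 h2)]
  ring

theorem gammaQuot_add_one {y : ℝ} (hy : -(1 / 4) < y) :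
    gammaQuot (y + 1) = (y + 3 / 4) / (y + 1 / 4) * gammaQuot y := by
  have h1 := gammaQuot_mul_shift hy
  have h2 := gammaQuot_mul_shift (y := y + 1 / 2) (by linarith)
  have e1 : y + 1 / 2 + 1 / 2 = y + 1 := by ring
  have e2 : y + 1 / 2 + 1 / 4 = y + 3 / 4 := by ring
  rw [e1, e2] at h2
  have h3 := gammaQuot_pos (y := y + 1 / 2) (by linarith)
  rw [eq_comm, div_mul_eq_mul_div, div_eq_iff (by linarith), ← h1, ← h2]
  ring

theorem gammaQuot_sq_le_add {y : ℝ} (hy : -(1 / 4) < y) : gammaQuot y ^ 2 ≤ y + 1 / 4 := by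
  have h1 : 0 < Real.Gamma (y + 1 / 4) := Real.Gamma_pos_of_pos (by linarith)
  have h := Gamma_midpoint_sq_le (s := y + 1 / 4) (t := y + 1 / 4 + 1) (by linarith) (by linarith)
  have e : (y + 1 / 4 + (y + 1 / 4 + 1)) / 2 = y + 3 / 4 := by ring
  rw [e, Real.Gamma_add_one (by linarith)] at h
  rw [gammaQuot, div_pow, div_le_iff₀ (by positivity)]
  linarith

/-- By `gammaQuot_add_one` this is a rational inequality; after clearing denominators every
coefficient of the difference is nonnegative. -/
theorem gammaQuot_sq_step {y : ℝ} (hy : 0 < y) :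
    gammaQuot y ^ 2 / (y + 1 / (32 * y)) ≤
      gammaQuot (y + 1) ^ 2 / (y + 1 + 1 / (32 * (y + 1))) := by
  have hG := gammaQuot_pos (y := y) (by linarith)
  have key : (y + 1 + 1 / (32 * (y + 1))) * (y + 1 / 4) ^ 2 ≤
      (y + 3 / 4) ^ 2 * (y + 1 / (32 * y)) := by
    rw [← sub_nonneg]
    have e : (y + 3 / 4) ^ 2 * (y + 1 / (32 * y)) -
        (y + 1 + 1 / (32 * (y + 1))) * (y + 1 / 4) ^ 2 =
        ((y + 3 / 4) ^ 2 * (32 * y ^ 2 + 1) * (y + 1) -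
          (32 * (y + 1) ^ 2 + 1) * y * (y + 1 / 4) ^ 2) / (32 * y * (y + 1)) := by
      field_simp
    rw [e]
    refine div_nonneg ?_ (by positivity)
    ring_nf
    positivity
  rw [gammaQuot_add_one (by linarith), div_le_div_iff₀ (by positivity) (by positivity),
    mul_pow, div_pow, div_mul_eq_mul_div, div_mul_eq_mul_div, le_div_iff₀ (by positivity)]
  have := mul_le_mul_of_nonneg_left key (sq_nonneg (gammaQuot y))
  linarith

/-- The ratio of the two sides increases along `y, y + 1, y + 2, …`, and the crude bound from
log-convexity keeps it below a sequence tending to `1`. Hence it is at most `1` from the start. -/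
theorem gammaQuot_sq_le {y : ℝ} (hy : 0 < y) : gammaQuot y ^ 2 ≤ y + 1 / (32 * y) := by
  have hmono : Monotone fun k : ℕ =>
      gammaQuot (y + k) ^ 2 / (y + k + 1 / (32 * (y + k))) := by
    refine monotone_nat_of_le_succ fun k => ?_
    have := gammaQuot_sq_step (y := y + k) (by positivity)
    push_cast
    rwa [← add_assoc]
  have hlim : Tendsto (fun k : ℕ => (y + k + 1 / 4) / (y + k)) atTop (𝓝 1) := by
    have h1 : Tendsto (fun k : ℕ => y + (k : ℝ)) atTop atTop :=
      tendsto_atTop_add_const_left _ _ tendsto_natCast_atTop_atTop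
    have h2 : Tendsto (fun k : ℕ => 1 + 1 / 4 * (y + (k : ℝ))⁻¹) atTop (𝓝 (1 + 1 / 4 * 0)) :=
      (h1.inv_tendsto_atTop.const_mul _).const_add _
    rw [mul_zero, add_zero] at h2
    refine h2.congr fun k => ?_
    have : y + (k : ℝ) ≠ 0 := by positivity
    field_simp
  have hle : ∀ k : ℕ, gammaQuot (y + k) ^ 2 / (y + k + 1 / (32 * (y + k))) ≤
      (y + k + 1 / 4) / (y + k) := by
    intro k
    have hk : 0 < y + (k : ℝ) := by positivity
    have h1 := gammaQuot_sq_le_add (y := y + k) (by linarith)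
    have : 0 < 1 / (32 * (y + k)) := by positivity
    exact div_le_div₀ (by linarith) h1 hk (by linarith)
  have h := ge_of_tendsto' hlim fun k => (hmono (Nat.zero_le k)).trans (hle k)
  simp only [Nat.cast_zero, add_zero] at h
  rwa [div_le_one (by positivity)] at h

/-- The product of the quotients at `y` and `y + 1/2` is known exactly, so the upper bound at `y +
1/2` becomes a lower bound at `y`. -/
theorem le_mul_gammaQuot_sq_sub {y : ℝ} (hy : 0 < y) :
    1 / 32 * (1 + y⁻¹)⁻¹ ≤ y * (gammaQuot y ^ 2 - y) := by
  have h := gammaQuot_mul_shift (y := y) (by linarith)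
  have h1 := gammaQuot_sq_le (y := y + 1 / 2) (by linarith)
  have h2 : 1 / (32 * (y + 1 / 2)) ≤ 1 / 16 := by
    rw [div_le_div_iff₀ (by positivity) (by norm_num)]
    linarith
  have h3 : y / (32 * (y + 1 / 2)) ≤ 1 / 32 := by
    rw [div_le_div_iff₀ (by positivity) (by norm_num)]
    linarith
  set t := 1 / (32 * (y + 1 / 2)) with ht
  have h4 : (y + 1 / 4) ^ 2 ≤ gammaQuot y ^ 2 * (y + 1 / 2 + t) := by
    rw [← h, mul_pow]
    exact mul_le_mul_of_nonneg_left h1 (sq_nonneg _)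
  have h5 : y * t ≤ 1 / 32 := by rw [ht, mul_one_div]; exact h3
  have ht0 : 0 < t := by positivity
  have h6 : 1 / 32 ≤ (gammaQuot y ^ 2 - y) * (y + 1 / 2 + t) := by nlinarith
  have h7 : 0 < gammaQuot y ^ 2 - y := by
    by_contra! hcon
    nlinarith [mul_nonneg (neg_nonneg.2 hcon) (by positivity : 0 ≤ y + 1 / 2 + t)]
  have e : 1 / 32 * (1 + y⁻¹)⁻¹ = (y * (1 / 32)) / (y + 1) := by
    field_simp
  have h8 : (gammaQuot y ^ 2 - y) * (y + 1 / 2 + t) ≤ (gammaQuot y ^ 2 - y) * (y + 1) :=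
    mul_le_mul_of_nonneg_left (by linarith) h7.le
  rw [e, div_le_iff₀ (by positivity), mul_assoc]
  exact mul_le_mul_of_nonneg_left (h6.trans h8) hy.le

theorem tendsto_gammaQuot_sq_sub :
    Tendsto (fun y : ℝ => y * (gammaQuot y ^ 2 - y)) atTop (𝓝 (1 / 32)) := by
  have hinv : Tendsto (fun y : ℝ => y⁻¹) atTop (𝓝 0) := tendsto_inv_atTop_zero
  have hlow : Tendsto (fun y : ℝ => 1 / 32 * (1 + y⁻¹)⁻¹) atTop (𝓝 (1 / 32)) := by
    simpa using ((hinv.const_add 1).inv₀ (by norm_num)).const_mul (1 / 32 : ℝ)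
  refine tendsto_of_tendsto_of_tendsto_of_le_of_le' hlow tendsto_const_nhds ?_ ?_
  · filter_upwards [eventually_gt_atTop 0] with y hy using le_mul_gammaQuot_sq_sub hy
  · filter_upwards [eventually_gt_atTop 0] with y hy
    have h := mul_le_mul_of_nonneg_left (gammaQuot_sq_le hy) hy.le
    have e : y * (y + 1 / (32 * y)) = y * y + 1 / 32 := by field_simp
    nlinarith

/-! ### The sequences `α` and `β` -/

/-- Merges the even and the odd formula into one expression in `n`, so that parity plays no role
afterwards. -/
theorem alpha_sq {lam : ℝ} (hl : 0 ≤ lam) {n : ℕ} (hn : 1 ≤ n) :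
    alpha lam n ^ 2 = 2 * gammaQuot ((2 * n + 1) / 4) * gammaQuot ((2 * n + 4 * lam - 1) / 4) /
      (n + lam) := by
  have hn' : (1 : ℝ) ≤ n := by exact_mod_cast hn
  rcases Nat.even_or_odd' n with ⟨m, rfl | rfl⟩
  · have hm : (1 : ℝ) ≤ m := by exact_mod_cast (by omega : 1 ≤ m)
    have e : 2 * m / 2 = m := by omega
    have g1 := Real.Gamma_pos_of_pos (s := m + lam + 1 / 2) (by linarith)
    have g2 := Real.Gamma_pos_of_pos (s := m + 1 / 2) (by linarith)
    have g3 := Real.Gamma_pos_of_pos (s := m + lam) (by linarith)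
    have g4 : 0 < 2 * m + lam := by linarith
    rw [alpha, if_pos (even_two_mul m), e, Real.sq_sqrt (by positivity), gammaQuot, gammaQuot,
      ← Real.Gamma_nat_eq_factorial]
    push_cast
    have e1 : (2 * (2 * (m : ℝ)) + 1) / 4 + 3 / 4 = m + 1 := by ring
    have e2 : (2 * (2 * (m : ℝ)) + 1) / 4 + 1 / 4 = m + 1 / 2 := by ring
    have e3 : (2 * (2 * (m : ℝ)) + 4 * lam - 1) / 4 + 3 / 4 = m + lam + 1 / 2 := by ring
    have e4 : (2 * (2 * (m : ℝ)) + 4 * lam - 1) / 4 + 1 / 4 = m + lam := by ring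
    rw [e1, e2, e3, e4]
    simp only [div_eq_mul_inv, mul_inv]
    ring
  · have hm : (0 : ℝ) ≤ m := by positivity
    have e : (2 * m + 1) / 2 = m := by omega
    have g1 := Real.Gamma_pos_of_pos (s := m + 3 / 2) (by linarith)
    have g2 := Real.Gamma_pos_of_pos (s := m + 1 + lam) (by linarith)
    have g3 := Real.Gamma_pos_of_pos (s := m + 1) (by linarith)
    have g4 := Real.Gamma_pos_of_pos (s := m + lam + 1 / 2) (by linarith)
    rw [alpha, if_neg (Nat.not_even_iff_odd.2 (odd_two_mul_add_one m)), e,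
      Real.sq_sqrt (by positivity), gammaQuot, gammaQuot]
    push_cast
    have e1 : (2 * (2 * (m : ℝ) + 1) + 1) / 4 + 3 / 4 = m + 3 / 2 := by ring
    have e2 : (2 * (2 * (m : ℝ) + 1) + 1) / 4 + 1 / 4 = m + 1 := by ring
    have e3 : (2 * (2 * (m : ℝ) + 1) + 4 * lam - 1) / 4 + 3 / 4 = m + 1 + lam := by ring
    have e4 : (2 * (2 * (m : ℝ) + 1) + 4 * lam - 1) / 4 + 1 / 4 = m + lam + 1 / 2 := by ring
    rw [e1, e2, e3, e4]
    simp only [div_eq_mul_inv, mul_inv]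
    ring

theorem alpha_pos {lam : ℝ} (hl : 0 ≤ lam) {n : ℕ} (hn : 1 ≤ n) : 0 < alpha lam n := by
  have hn' : (1 : ℝ) ≤ n := by exact_mod_cast hn
  have h : 0 < alpha lam n ^ 2 := by
    have h1 := gammaQuot_pos (y := (2 * n + 1) / 4) (by linarith)
    have h2 := gammaQuot_pos (y := (2 * n + 4 * lam - 1) / 4) (by linarith)
    rw [alpha_sq hl hn]
    positivity
  have h0 : 0 ≤ alpha lam n := by
    unfold alpha
    split_ifs <;> exact Real.sqrt_nonneg _
  exact lt_of_le_of_ne h0 fun h' => by simp [← h'] at h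

theorem alpha_sq_mul_alpha_sq {lam : ℝ} (hl : 0 ≤ lam) {n : ℕ} (hn : 1 ≤ n) :
    alpha lam n ^ 2 * alpha lam (n + 1) ^ 2 =
      (n + 1) * (n + 2 * lam) / ((n + lam) * (n + 1 + lam)) := by
  have hn' : (1 : ℝ) ≤ n := by exact_mod_cast hn
  have h1 := gammaQuot_mul_shift (y := (2 * n + 1) / 4) (by linarith)
  have h2 := gammaQuot_mul_shift (y := (2 * n + 4 * lam - 1) / 4) (by linarith)
  rw [alpha_sq hl hn, alpha_sq hl (by omega : 1 ≤ n + 1)]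
  push_cast
  have e1 : (2 * ((n : ℝ) + 1) + 1) / 4 = (2 * n + 1) / 4 + 1 / 2 := by ring
  have e2 : (2 * ((n : ℝ) + 1) + 4 * lam - 1) / 4 = (2 * n + 4 * lam - 1) / 4 + 1 / 2 := by ring
  rw [e1, e2, div_mul_div_comm]
  congr 1
  calc _ = 4 * (gammaQuot ((2 * n + 1) / 4) * gammaQuot ((2 * n + 1) / 4 + 1 / 2)) *
        (gammaQuot ((2 * n + 4 * lam - 1) / 4) *
          gammaQuot ((2 * n + 4 * lam - 1) / 4 + 1 / 2)) := by ring
    _ = _ := by rw [h1, h2]; ring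

/-- Let `x`, `y` be the two arguments in `alpha_sq`. Then `x + y = n + λ`, and `α_n⁴ (n+λ)² = 4 (x +
A/x)(y + B/y)` with `A, B → 1/32`. Since `(x+y)² - 4xy = (y-x)² = (2λ-1)²/4`, the limit is
`(2λ-1)²/4 - 4(1/32 + 1/32)`. -/
theorem tendsto_one_sub_alpha_pow_four_mul {lam : ℝ} (hl : 0 ≤ lam) :
    Tendsto (fun n : ℕ => (1 - (alpha lam n ^ 2) ^ 2) * (n + lam) ^ 2) atTop
      (𝓝 (lam * (lam - 1))) := by
  have hy1 : Tendsto (fun n : ℕ => (2 * (n : ℝ) + 1) / 4) atTop atTop :=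
    ((tendsto_natCast_atTop_atTop.const_mul_atTop (by norm_num : (0 : ℝ) < 2)).atTop_add
      tendsto_const_nhds).atTop_div_const (by norm_num)
  have hy2 : Tendsto (fun n : ℕ => (2 * (n : ℝ) + (4 * lam - 1)) / 4) atTop atTop :=
    ((tendsto_natCast_atTop_atTop.const_mul_atTop (by norm_num : (0 : ℝ) < 2)).atTop_add
      tendsto_const_nhds).atTop_div_const (by norm_num)
  have h1 := tendsto_gammaQuot_sq_sub.comp hy1
  have h2 := tendsto_gammaQuot_sq_sub.comp hy2
  have hr : Tendsto (fun n : ℕ => (1 - 2 * lam) / 2 * ((2 * (n : ℝ) + (4 * lam - 1)) / 4)⁻¹)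
      atTop (𝓝 0) := by
    simpa using hy2.inv_tendsto_atTop.const_mul ((1 - 2 * lam) / 2)
  have hr' : Tendsto (fun n : ℕ => (2 * lam - 1) / 2 * ((2 * (n : ℝ) + 1) / 4)⁻¹)
      atTop (𝓝 0) := by
    simpa using hy1.inv_tendsto_atTop.const_mul ((2 * lam - 1) / 2)
  have h3 := (((h2.mul (hr.const_add 1)).add (h1.mul (hr'.const_add 1))).add
    ((h1.mul h2).mul ((hy1.inv_tendsto_atTop).mul (hy2.inv_tendsto_atTop)))).const_mul 4
  have h4 := h3.const_sub ((2 * lam - 1) ^ 2 / 4)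
  have e : (2 * lam - 1) ^ 2 / 4 - 4 * (1 / 32 * (1 + 0) + 1 / 32 * (1 + 0) +
      1 / 32 * (1 / 32) * (0 * 0)) = lam * (lam - 1) := by ring
  rw [e] at h4
  refine h4.congr' ?_
  filter_upwards [eventually_ge_atTop 1] with n hn
  have hn' : (1 : ℝ) ≤ n := by exact_mod_cast hn
  have p1 : 0 < (2 * (n : ℝ) + 1) / 4 := by linarith
  have p2 : 0 < (2 * (n : ℝ) + (4 * lam - 1)) / 4 := by linarith
  have hE : ((alpha lam n) ^ 2) ^ 2 * (n + lam) ^ 2 =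
      4 * (gammaQuot ((2 * n + 1) / 4) ^ 2 * gammaQuot ((2 * n + (4 * lam - 1)) / 4) ^ 2) := by
    have e' : (2 * (n : ℝ) + 4 * lam - 1) / 4 = (2 * n + (4 * lam - 1)) / 4 := by ring
    have : (n : ℝ) + lam ≠ 0 := by positivity
    rw [alpha_sq hl hn, e']
    field_simp
    ring
  rw [sub_mul, hE]
  simp only [Function.comp, Pi.inv_apply]
  set A := gammaQuot ((2 * n + 1) / 4) ^ 2
  set B := gammaQuot ((2 * n + (4 * lam - 1)) / 4) ^ 2
  obtain ⟨x, hx⟩ : ∃ x, x = (2 * (n : ℝ) + 1) / 4 := ⟨_, rfl⟩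
  obtain ⟨y, hy⟩ : ∃ y, y = (2 * (n : ℝ) + (4 * lam - 1)) / 4 := ⟨_, rfl⟩
  have exy : (2 * lam - 1) / 2 = y - x := by rw [hx, hy]; ring
  have exy' : (1 - 2 * lam) / 2 = x - y := by rw [hx, hy]; ring
  have exn : (n : ℝ) + lam = x + y := by rw [hx, hy]; ring
  have e5 : (2 * lam - 1) ^ 2 / 4 = (y - x) ^ 2 := by rw [hx, hy]; ring
  rw [e5, exy, exy', exn, ← hx, ← hy]
  rw [← hx] at p1
  rw [← hy] at p2
  field_simp
  ring

theorem tendsto_alpha_sq {lam : ℝ} (hl : 0 ≤ lam) :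
    Tendsto (fun n : ℕ => alpha lam n ^ 2) atTop (𝓝 1) := by
  have hn : Tendsto (fun n : ℕ => ((n : ℝ) + lam)) atTop atTop :=
    tendsto_natCast_atTop_atTop.atTop_add tendsto_const_nhds
  have h := ((tendsto_one_sub_alpha_pow_four_mul hl).mul
    (hn.inv_tendsto_atTop.mul hn.inv_tendsto_atTop)).const_sub 1
  have h2 : Tendsto (fun n : ℕ => (alpha lam n ^ 2) ^ 2) atTop (𝓝 1) := by
    have e : 1 - lam * (lam - 1) * (0 * 0) = 1 := by ring
    rw [e] at h
    refine h.congr' ?_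
    filter_upwards [eventually_ge_atTop 1] with n hn
    have hn' : (1 : ℝ) ≤ n := by exact_mod_cast hn
    have : (n : ℝ) + lam ≠ 0 := by positivity
    simp only [Pi.inv_apply]
    field_simp
    ring
  have h3 := h2.sqrt
  simp only [Real.sqrt_one] at h3
  exact h3.congr fun n => Real.sqrt_sq (sq_nonneg _)

theorem tendsto_one_sub_alpha_sq_mul {lam : ℝ} (hl : 0 ≤ lam) :
    Tendsto (fun n : ℕ => (1 - alpha lam n ^ 2) * (n : ℝ) ^ 2) atTop
      (𝓝 (lam * (lam - 1) / 2)) := by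
  have hn : Tendsto (fun n : ℕ => ((n : ℝ) + lam)) atTop atTop :=
    tendsto_natCast_atTop_atTop.atTop_add tendsto_const_nhds
  have h1 : Tendsto (fun n : ℕ => 1 - lam * ((n : ℝ) + lam)⁻¹) atTop (𝓝 (1 - lam * 0)) :=
    (hn.inv_tendsto_atTop.const_mul lam).const_sub 1
  -- Uses `1 - α² = (1 - α⁴)/(1 + α²)`.
  have h := ((tendsto_one_sub_alpha_pow_four_mul hl).mul (h1.pow 2)).div
    ((tendsto_alpha_sq hl).const_add 1) (by norm_num)
  have e : lam * (lam - 1) * (1 - lam * 0) ^ 2 / (1 + 1) = lam * (lam - 1) / 2 := by ring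
  rw [e] at h
  refine h.congr' ?_
  filter_upwards [eventually_ge_atTop 1] with n hn
  have hn' : (1 : ℝ) ≤ n := by exact_mod_cast hn
  have h0 : (n : ℝ) + lam ≠ 0 := by positivity
  have h2 : 1 + alpha lam n ^ 2 ≠ 0 := by positivity
  simp only [Pi.div_apply]
  field_simp
  ring

theorem tendsto_beta {lam : ℝ} (hl : 0 ≤ lam) :
    Tendsto (beta lam) atTop (𝓝 (betaInf lam)) := by
  have hinv : Tendsto (fun n : ℕ => 1 + 2 * lam * ((n : ℝ))⁻¹) atTop (𝓝 (1 + 2 * lam * 0)) :=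
    (tendsto_natCast_atTop_atTop.inv_tendsto_atTop.const_mul (2 * lam)).const_add 1
  have h := ((tendsto_one_sub_alpha_sq_mul hl).add ((tendsto_alpha_sq hl).div_const 8)).mul hinv
  have e : (lam * (lam - 1) / 2 + 1 / 8) * (1 + 2 * lam * 0) = betaInf lam := by
    rw [betaInf]; ring
  rw [e] at h
  refine h.congr' ?_
  filter_upwards [eventually_ge_atTop 1] with n hn
  have hn' : (1 : ℝ) ≤ n := by exact_mod_cast hn
  rw [beta]
  field_simp

/-! ### Thresholds and the integer `n(d)` -/

theorem mem_thresholds_iff {lam : ℝ} (hl : 0 ≤ lam) {N : ℕ} :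
    N ∈ thresholds lam ↔ ∀ n : ℕ, 1 ≤ n → N ≤ n → betaInf lam ≤ beta lam n := by
  constructor
  · exact fun h n h1 h2 => h.1 ⟨n, ⟨h1, h2⟩, rfl⟩
  · refine fun h => ⟨?_, fun b hb => ?_⟩
    · rintro _ ⟨n, ⟨h1, h2⟩, rfl⟩
      exact h n h1 h2
    -- A lower bound of a tail never exceeds the limit, so only the other half of `IsGLB` is a
    -- restriction.
    · refine ge_of_tendsto (tendsto_beta hl) ?_
      filter_upwards [eventually_ge_atTop (max 1 N)] with n hn
      exact hb ⟨n, ⟨(le_max_left _ _).trans hn, (le_max_right _ _).trans hn⟩, rfl⟩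

theorem alpha_pow_four_mul_le {lam : ℝ} (hl : 0 ≤ lam) {n : ℕ} (hn : 1 ≤ n) :
    (alpha lam n ^ 2) ^ 2 * (16 * (2 * n + 1) * (2 * n + 4 * lam - 1) * (n + lam) ^ 2) ≤
      (2 * (2 * n + 1) ^ 2 + 1) * (2 * (2 * n + 4 * lam - 1) ^ 2 + 1) := by
  have hn' : (1 : ℝ) ≤ n := by exact_mod_cast hn
  obtain ⟨x, hx⟩ : ∃ x, x = (2 * (n : ℝ) + 1) / 4 := ⟨_, rfl⟩
  obtain ⟨y, hy⟩ : ∃ y, y = (2 * (n : ℝ) + 4 * lam - 1) / 4 := ⟨_, rfl⟩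
  have hx0 : 0 < x := by linarith
  have hy0 : 0 < y := by linarith
  have h0 : (n : ℝ) + lam ≠ 0 := by positivity
  have e1 : 2 * (n : ℝ) + 1 = 4 * x := by rw [hx]; ring
  have e2 : 2 * (n : ℝ) + 4 * lam - 1 = 4 * y := by rw [hy]; ring
  have h1 : gammaQuot x ^ 2 * x ≤ x ^ 2 + 1 / 32 := by
    have := mul_le_mul_of_nonneg_right (gammaQuot_sq_le hx0) hx0.le
    have e : (x + 1 / (32 * x)) * x = x ^ 2 + 1 / 32 := by field_simp
    linarith
  have h2 : gammaQuot y ^ 2 * y ≤ y ^ 2 + 1 / 32 := by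
    have := mul_le_mul_of_nonneg_right (gammaQuot_sq_le hy0) hy0.le
    have e : (y + 1 / (32 * y)) * y = y ^ 2 + 1 / 32 := by field_simp
    linarith
  have h3 := mul_le_mul h1 h2 (by positivity) (by positivity)
  rw [alpha_sq hl hn, ← hx, ← hy, e1, e2]
  have e3 : (2 * gammaQuot x * gammaQuot y / (n + lam)) ^ 2 *
      (16 * (4 * x) * (4 * y) * (n + lam) ^ 2) =
      1024 * (gammaQuot x ^ 2 * x * (gammaQuot y ^ 2 * y)) := by
    field_simp
    ring
  rw [e3]
  nlinarith

/-- The claim is equivalent to `α² (n+2λ)(8n²-1) ≤ n(8n(n+2λ) - (2λ-1)²)`. Both sides are squared,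
`h1` giving the sign of the right one, and `α⁴` is replaced by its rational upper bound. -/
theorem betaInf_le_beta_of_poly {lam : ℝ} (hl : 0 ≤ lam) {n : ℕ} (hn : 1 ≤ n)
    (h1 : (2 * lam - 1) ^ 2 ≤ 8 * n * (n + 2 * lam))
    (h2 : 0 ≤ 16 * (2 * n + 1) * (2 * n + 4 * lam - 1) * (n + lam) ^ 2 *
      (n * (8 * n * (n + 2 * lam) - (2 * lam - 1) ^ 2)) ^ 2 -
      (2 * (2 * n + 1) ^ 2 + 1) * (2 * (2 * n + 4 * lam - 1) ^ 2 + 1) *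
        ((n + 2 * lam) * (8 * (n : ℝ) ^ 2 - 1)) ^ 2) :
    betaInf lam ≤ beta lam n := by
  have hn' : (1 : ℝ) ≤ n := by exact_mod_cast hn
  have h3 := alpha_pow_four_mul_le hl hn
  rw [beta, betaInf]
  set a := alpha lam n ^ 2
  have hY : 0 ≤ (n : ℝ) * (8 * n * (n + 2 * lam) - (2 * lam - 1) ^ 2) :=
    mul_nonneg (by linarith) (by linarith)
  have hD : 0 < 16 * (2 * (n : ℝ) + 1) * (2 * n + 4 * lam - 1) * (n + lam) ^ 2 := by
    have : 0 < 2 * (n : ℝ) + 4 * lam - 1 := by linarith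
    positivity
  have key : a * ((n + 2 * lam) * (8 * (n : ℝ) ^ 2 - 1)) ≤
      n * (8 * n * (n + 2 * lam) - (2 * lam - 1) ^ 2) := by
    refine le_of_sq_le_sq ?_ hY
    rw [← mul_le_mul_iff_right₀ hD, mul_pow]
    have := mul_le_mul_of_nonneg_right h3
      (sq_nonneg ((n + 2 * lam) * (8 * (n : ℝ) ^ 2 - 1)))
    linarith
  have e : (1 - a + a / (8 * (n : ℝ) ^ 2)) * (n * (n + 2 * lam)) - (2 * lam - 1) ^ 2 / 8 =
      (n * (8 * n * (n + 2 * lam) - (2 * lam - 1) ^ 2) -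
        a * ((n + 2 * lam) * (8 * (n : ℝ) ^ 2 - 1))) / (8 * n) := by
    field_simp
    ring
  rw [← sub_nonneg, e]
  exact div_nonneg (by linarith) (by positivity)

/-- In the nonnegative variables `s`, `t` both polynomial conditions expand with nonnegative
coefficients. The `- 1` leaves room for the floor in `floor_mem_thresholds`. -/
theorem betaInf_le_beta_of_cube_le {lam : ℝ} (hl : 2 ≤ lam) {n : ℕ}
    (hn : 3 / 2 * lam ^ 3 - 1 ≤ n) : betaInf lam ≤ beta lam n := by
  obtain ⟨s, hs, rfl⟩ : ∃ s : ℝ, 0 ≤ s ∧ lam = 2 + s := ⟨lam - 2, by linarith, by ring⟩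
  obtain ⟨t, ht, hnt⟩ : ∃ t : ℝ, 0 ≤ t ∧ (n : ℝ) = 3 / 2 * (2 + s) ^ 3 - 1 + t :=
    ⟨n - (3 / 2 * (2 + s) ^ 3 - 1), by linarith, by ring⟩
  have hn1 : 1 ≤ n := by
    have : (1 : ℝ) ≤ n := by
      rw [hnt]
      ring_nf
      nlinarith [pow_nonneg hs 2, pow_nonneg hs 3]
    exact_mod_cast this
  refine betaInf_le_beta_of_poly (by linarith) hn1 ?_ ?_
  · rw [← sub_nonneg, hnt]
    ring_nf
    positivity
  · rw [hnt]
    ring_nf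
    positivity

theorem betaInf_le_beta_three_halves {n : ℕ} (hn : 1 ≤ n) :
    betaInf (3 / 2) ≤ beta (3 / 2) n := by
  obtain ⟨t, ht, hnt⟩ : ∃ t : ℝ, 0 ≤ t ∧ (n : ℝ) = 1 + t :=
    ⟨n - 1, by rw [sub_nonneg]; exact_mod_cast hn, by ring⟩
  refine betaInf_le_beta_of_poly (by norm_num) hn ?_ ?_
  · rw [← sub_nonneg, hnt]
    ring_nf
    positivity
  · rw [hnt]
    ring_nf
    positivity

/-- The two arguments in `alpha_sq` differ by `λ - 1/2`. For `λ = 0` and `λ = 1` the product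
collapses by `gammaQuot_mul_shift`; for `λ = 2` one more unit shift is needed. -/
theorem alpha_zero_sq {n : ℕ} (hn : 1 ≤ n) : alpha 0 n ^ 2 = 1 := by
  have hn' : (1 : ℝ) ≤ n := by exact_mod_cast hn
  have h := gammaQuot_mul_shift (y := (2 * n + 4 * 0 - 1) / 4) (by linarith)
  have e : (2 * (n : ℝ) + 4 * 0 - 1) / 4 + 1 / 2 = (2 * n + 1) / 4 := by ring
  rw [e] at h
  rw [alpha_sq le_rfl hn, div_eq_one_iff_eq (by linarith), mul_assoc,
    mul_comm (gammaQuot ((2 * n + 1) / 4)), h]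
  ring

theorem alpha_one_sq {n : ℕ} (hn : 1 ≤ n) : alpha 1 n ^ 2 = 1 := by
  have hn' : (1 : ℝ) ≤ n := by exact_mod_cast hn
  have h := gammaQuot_mul_shift (y := (2 * n + 1) / 4) (by linarith)
  have e : (2 * (n : ℝ) + 1) / 4 + 1 / 2 = (2 * n + 4 * 1 - 1) / 4 := by ring
  rw [e] at h
  rw [alpha_sq zero_le_one hn, div_eq_one_iff_eq (by linarith), mul_assoc, h]
  ring

theorem alpha_two_sq {n : ℕ} (hn : 1 ≤ n) :
    alpha 2 n ^ 2 = (n + 1) * (n + 3) / (n + 2) ^ 2 := by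
  have hn' : (1 : ℝ) ≤ n := by exact_mod_cast hn
  have h := gammaQuot_mul_shift (y := (2 * n + 1) / 4) (by linarith)
  have h2 := gammaQuot_add_one (y := (2 * n + 1) / 4 + 1 / 2) (by linarith)
  have e : (2 * (n : ℝ) + 1) / 4 + 1 / 2 + 1 = (2 * n + 4 * 2 - 1) / 4 := by ring
  rw [e] at h2
  rw [alpha_sq zero_le_two hn, h2, mul_left_comm, mul_assoc 2, h]
  field_simp
  ring

theorem beta_zero {n : ℕ} (hn : 1 ≤ n) : beta 0 n = 1 / 8 := by
  have hn' : (n : ℝ) ≠ 0 := by positivity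
  rw [beta, alpha_zero_sq hn]
  field_simp
  ring

theorem beta_one {n : ℕ} (hn : 1 ≤ n) : beta 1 n = 1 / 8 + 1 / (4 * n) := by
  have hn' : (n : ℝ) ≠ 0 := by positivity
  rw [beta, alpha_one_sq hn]
  field_simp
  ring

theorem beta_two {n : ℕ} (hn : 1 ≤ n) :
    beta 2 n = 9 / 8 + (4 * n ^ 2 - 17 * n + 12) / (8 * n * (n + 2 : ℝ) ^ 2) := by
  have hn' : (n : ℝ) ≠ 0 := by positivity
  rw [beta, alpha_two_sq hn]
  field_simp
  ring

theorem zero_mem_thresholds_zero : 0 ∈ thresholds 0 := by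
  rw [mem_thresholds_iff le_rfl]
  intro n hn _
  rw [beta_zero hn, betaInf]
  norm_num

theorem zero_mem_thresholds_one : 0 ∈ thresholds 1 := by
  rw [mem_thresholds_iff zero_le_one]
  intro n hn _
  have : (0 : ℝ) ≤ 1 / (4 * n) := by positivity
  rw [beta_one hn, betaInf]
  linarith

theorem zero_mem_thresholds_three_halves : 0 ∈ thresholds (3 / 2) := by
  rw [mem_thresholds_iff (by norm_num)]
  exact fun n hn _ => betaInf_le_beta_three_halves hn

theorem floor_mem_thresholds {lam : ℝ} (hl : 2 ≤ lam) : ⌊3 / 2 * lam ^ 3⌋₊ ∈ thresholds lam := by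
  rw [mem_thresholds_iff (by linarith)]
  intro n _ hn
  refine betaInf_le_beta_of_cube_le hl ?_
  have h := Nat.lt_floor_add_one (3 / 2 * lam ^ 3)
  have : ((⌊3 / 2 * lam ^ 3⌋₊ : ℕ) : ℝ) ≤ n := by exact_mod_cast hn
  linarith

theorem index_eq_zero {d : ℕ} (h : 0 ∈ thresholds (((d : ℝ) - 2) / 2)) : index d = 0 :=
  Nat.sInf_eq_zero.2 (Or.inl h)

theorem index_two : index 2 = 0 := index_eq_zero (by
  convert zero_mem_thresholds_zero using 2; norm_num)

theorem index_four : index 4 = 0 := index_eq_zero (by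
  convert zero_mem_thresholds_one using 2; norm_num)

theorem index_five : index 5 = 0 := index_eq_zero (by
  convert zero_mem_thresholds_three_halves using 2; norm_num)

theorem mem_thresholds_two_iff {N : ℕ} : N ∈ thresholds 2 ↔ 4 ≤ N := by
  rw [mem_thresholds_iff zero_le_two]
  have hb : betaInf 2 = 9 / 8 := by rw [betaInf]; norm_num
  rw [hb]
  constructor
  · intro h
    by_contra! hN
    -- The numerator `4n² - 17n + 12` in `beta_two` equals `-3` at `n = 3` and is positive from `n =
    -- 4` on.
    have h3 := h 3 (by norm_num) (by omega)
    rw [beta_two (by norm_num)] at h3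
    norm_num at h3
  · intro hN n hn hNn
    have hn' : (4 : ℝ) ≤ n := by exact_mod_cast hN.trans hNn
    rw [beta_two hn, le_add_iff_nonneg_right]
    exact div_nonneg (by nlinarith) (by positivity)

theorem index_six : index 6 = 4 := by
  have e : (((6 : ℕ) : ℝ) - 2) / 2 = 2 := by norm_num
  have h : thresholds 2 = Set.Ici 4 := Set.ext fun N => mem_thresholds_two_iff
  rw [index, e, h, csInf_Ici]

theorem thresholds_nonempty_and_index_le {d : ℕ} (hd : 4 ≤ d) :
    (thresholds (((d : ℝ) - 2) / 2)).Nonempty ∧ (index d : ℝ) ≤ 3 * ((d : ℝ) - 2) ^ 3 / 16 := by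
  have key : ∀ N ∈ thresholds (((d : ℝ) - 2) / 2), (N : ℝ) ≤ 3 * ((d : ℝ) - 2) ^ 3 / 16 →
      (thresholds (((d : ℝ) - 2) / 2)).Nonempty ∧
        (index d : ℝ) ≤ 3 * ((d : ℝ) - 2) ^ 3 / 16 := by
    intro N hN hle
    have : (index d : ℝ) ≤ N := Nat.cast_le.2 (Nat.sInf_le hN)
    exact ⟨⟨N, hN⟩, this.trans hle⟩
  obtain rfl | rfl | h6 : d = 4 ∨ d = 5 ∨ 6 ≤ d := by omega
  · refine key 0 ?_ (by norm_num)
    convert zero_mem_thresholds_one using 2; norm_num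
  · refine key 0 ?_ (by norm_num)
    convert zero_mem_thresholds_three_halves using 2; norm_num
  · have h6' : (6 : ℝ) ≤ d := by exact_mod_cast h6
    refine key _ (floor_mem_thresholds (by linarith)) ?_
    refine (Nat.floor_le (by have : (0:ℝ) ≤ d - 2 := by linarith
                             positivity)).trans (le_of_eq ?_)
    ring

theorem thresholds_mono {lam : ℝ} (hl : 0 ≤ lam) {N K : ℕ} (hN : N ∈ thresholds lam)
    (hNK : N ≤ K) : K ∈ thresholds lam := by
  rw [mem_thresholds_iff hl] at hN ⊢
  exact fun n h1 h2 => hN n h1 (hNK.trans h2)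

open MeasureTheory MvPolynomial

/-- The Euclidean space `ℝ^d`. -/
abbrev Euc (d : ℕ) : Type := EuclideanSpace ℝ (Fin d)

/-! ### Integrals of homogeneous polynomials against the Gaussian weight -/

theorem integrable_volumeIoiPow (k N : ℕ) :
    Integrable (fun r : Set.Ioi (0 : ℝ) => (r : ℝ) ^ N * Real.exp (-((r : ℝ) ^ 2) / 2))
      (Measure.volumeIoiPow k) := by
  rw [Measure.volumeIoiPow, integrable_withDensity_iff_integrable_smul' (by fun_prop)
    (Eventually.of_forall fun _ => ENNReal.ofReal_lt_top)]
  have h := (integrable_rpow_mul_exp_neg_mul_sq (b := 1 / 2) (by norm_num) (s := (k + N : ℕ))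
    (by have : (0 : ℝ) ≤ ((k + N : ℕ) : ℝ) := Nat.cast_nonneg _
        linarith)).integrableOn (s := Set.Ioi 0)
  rw [← integrableOn_univ]
  have h2 := (MeasurableEmbedding.subtype_coe measurableSet_Ioi).integrableOn_iff_comap
    (f := fun r : ℝ => r ^ ((k + N : ℕ) : ℝ) * Real.exp (-(1 / 2) * r ^ 2)) (μ := volume)
    (s := Set.Ioi (0 : ℝ)) Subtype.range_coe.ge
  rw [h2] at h
  simp only [Subtype.coe_preimage_self] at h
  refine h.congr (Eventually.of_forall fun r => ?_)
  have hr : (0 : ℝ) ≤ r := r.2.le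
  simp only [Function.comp, smul_eq_mul, Real.rpow_natCast]
  rw [ENNReal.toReal_ofReal (by positivity), ← mul_assoc, pow_add]
  ring_nf

/-- The radial integral `∫ r ^ N exp (-r² / 2) r ^ (d - 1) dr`. -/
noncomputable def radialMoment (d N : ℕ) : ℝ :=
  ∫ r : Set.Ioi (0 : ℝ), (r : ℝ) ^ N * Real.exp (-((r : ℝ) ^ 2) / 2) ∂Measure.volumeIoiPow (d - 1)

theorem radialMoment_pos (d N : ℕ) : 0 < radialMoment d N := by
  have hpos : ∀ r : Set.Ioi (0 : ℝ), 0 < (r : ℝ) ^ N * Real.exp (-((r : ℝ) ^ 2) / 2) := fun r => by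
    have : (0 : ℝ) < r := r.2
    positivity
  rw [radialMoment, integral_pos_iff_support_of_nonneg (fun r => (hpos r).le)
    (integrable_volumeIoiPow _ _)]
  have : (Function.support fun r : Set.Ioi (0 : ℝ) =>
      (r : ℝ) ^ N * Real.exp (-((r : ℝ) ^ 2) / 2)) = Set.univ :=
    Set.eq_univ_of_forall fun r => (hpos r).ne'
  rw [this]
  have h1 : Measure.volumeIoiPow (d - 1) (Set.Iio ⟨1, Set.mem_Ioi.2 one_pos⟩) ≤
    Measure.volumeIoiPow (d - 1) Set.univ := measure_mono (Set.subset_univ _)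
  refine lt_of_lt_of_le ?_ h1
  rw [Measure.volumeIoiPow_apply_Iio, ENNReal.ofReal_pos]
  positivity

theorem eval_smul_of_isHomogeneous {d N : ℕ} {P : MvPolynomial (Fin d) ℝ}
    (hP : P.IsHomogeneous N) (r : ℝ) (x : Fin d → ℝ) :
    eval (fun i => r * x i) P = r ^ N * eval x P := by
  rw [eval_eq', eval_eq', Finset.mul_sum]
  refine Finset.sum_congr rfl fun m hm => ?_
  have h := hP (mem_support_iff.1 hm)
  rw [Finsupp.weight_apply, Finsupp.sum_fintype _ _ (by simp)] at h
  simp only [Pi.one_apply, smul_eq_mul, mul_one] at h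
  simp_rw [mul_pow]
  rw [Finset.prod_mul_distrib, Finset.prod_pow_eq_pow_sum, h]
  ring

/-- Polar coordinates. The spherical integral of a homogeneous polynomial is thus a positive
multiple of a Gaussian integral over the whole space, where integration by parts has no boundary
term. -/
theorem integrable_and_integral_gaussian {d N : ℕ} (hd : 1 ≤ d) {P : MvPolynomial (Fin d) ℝ}
    (hP : P.IsHomogeneous N) :
    Integrable (fun x : Euc d =>
      eval (fun i => x i) P * Real.exp (-‖x‖ ^ 2 / 2)) ∧
    ∫ x : Euc d, eval (fun i => x i) P * Real.exp (-‖x‖ ^ 2 / 2) =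
      (∫ x, restrict d P x ∂surf d) * radialMoment d N := by
  have : Nonempty (Fin d) := ⟨⟨0, hd⟩⟩
  have hdim : Module.finrank ℝ (Euc d) = d := by simp
  have hmp := (volume : Measure (Euc d)).measurePreserving_homeomorphUnitSphereProd
  rw [hdim] at hmp
  have hprod : Integrable (fun p : Sph d × Set.Ioi (0 : ℝ) => restrict d P p.1 *
      ((p.2 : ℝ) ^ N * Real.exp (-((p.2 : ℝ) ^ 2) / 2)))
      ((surf d).prod (Measure.volumeIoiPow (d - 1))) := by
    refine Integrable.mul_prod ?_ (integrable_volumeIoiPow _ _)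
    exact (restrict d P).continuous.integrable_of_hasCompactSupport
      (HasCompactSupport.of_compactSpace _)
  have hcomp : ∀ x : ({0}ᶜ : Set (Euc d)),
      restrict d P (homeomorphUnitSphereProd (Euc d) x).1 *
        (((homeomorphUnitSphereProd (Euc d) x).2 : ℝ) ^ N *
          Real.exp (-(((homeomorphUnitSphereProd (Euc d) x).2 : ℝ) ^ 2) / 2)) =
      eval (fun i => (x : Euc d) i) P * Real.exp (-‖(x : Euc d)‖ ^ 2 / 2) := by
    intro x
    have hx : ‖(x : Euc d)‖ ≠ 0 := norm_ne_zero_iff.2 x.2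
    have h := eval_smul_of_isHomogeneous hP ‖(x : Euc d)‖ (fun i => ‖(x : Euc d)‖⁻¹ * (x : Euc d) i)
    simp only [mul_inv_cancel_left₀ hx] at h
    rw [h]
    simp only [restrict, LinearMap.coe_mk, AddHom.coe_mk, ContinuousMap.coe_mk,
      homeomorphUnitSphereProd_apply_fst_coe, homeomorphUnitSphereProd_apply_snd_coe,
      PiLp.smul_apply, smul_eq_mul]
    ring
  constructor
  · rw [← restrict_compl_singleton (μ := volume) (0 : Euc d)]
    have := (MeasurableEmbedding.subtype_coe
      (measurableSet_singleton (0 : Euc d)).compl).integrableOn_iff_comap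
      (f := fun x : Euc d => eval (fun i => x i) P * Real.exp (-‖x‖ ^ 2 / 2)) (μ := volume)
      (s := ({0}ᶜ : Set (Euc d))) Subtype.range_coe.ge
    rw [← IntegrableOn, this]
    simp only [Subtype.coe_preimage_self, integrableOn_univ]
    have h2 := (hmp.integrable_comp_emb (Homeomorph.measurableEmbedding _)).2 hprod
    refine h2.congr (Eventually.of_forall fun x => ?_)
    exact hcomp x
  · rw [radialMoment, ← integral_prod_mul (fun x => restrict d P x)
      (fun r : Set.Ioi (0 : ℝ) => (r : ℝ) ^ N * Real.exp (-((r : ℝ) ^ 2) / 2)),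
      ← hmp.integral_comp (Homeomorph.measurableEmbedding _)]
    simp only [hcomp]
    rw [integral_subtype_comap (measurableSet_singleton _).compl
      (fun x : Euc d => eval (fun i => x i) P * Real.exp (-‖x‖ ^ 2 / 2)), restrict_compl_singleton]

theorem hasFDerivAt_eval {d : ℕ} (P : MvPolynomial (Fin d) ℝ) (x : Euc d) :
    HasFDerivAt (fun x : Euc d => eval (fun i => x i) P)
      (∑ i, eval (fun i => x i) (pderiv i P) •
        (EuclideanSpace.proj i : Euc d →L[ℝ] ℝ)) x := by
  induction P using MvPolynomial.induction_on with
  | C a => simpa using hasFDerivAt_const a x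
  | add p q hp hq =>
    simp only [map_add, add_smul, Finset.sum_add_distrib]
    exact hp.add hq
  | mul_X p j hp =>
    have hj : HasFDerivAt (fun x : Euc d => x j)
      (EuclideanSpace.proj j : Euc d →L[ℝ] ℝ) x :=
      (EuclideanSpace.proj j : Euc d →L[ℝ] ℝ).hasFDerivAt
    have h := hp.mul hj
    simp only [map_mul, eval_X]
    refine h.congr_fderiv ?_
    ext v
    simp only [Derivation.leibniz, pderiv_X, smul_eq_mul, map_add, map_mul, eval_X, add_mul,
      sum_apply, add_apply,
      smul_apply, Finset.sum_add_distrib, Finset.mul_sum]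
    simp [Pi.single_apply, apply_ite, mul_assoc]

theorem gaussian_integral_X_mul {d N : ℕ} (hd : 1 ≤ d) {P : MvPolynomial (Fin d) ℝ}
    (hP : P.IsHomogeneous N) (i : Fin d) :
    ∫ x : Euc d, eval (fun i => x i) (X i * P) * Real.exp (-‖x‖ ^ 2 / 2) =
      ∫ x : Euc d, eval (fun i => x i) (pderiv i P) *
        Real.exp (-‖x‖ ^ 2 / 2) := by
  have hw : ∀ x : Euc d, HasFDerivAt (fun x : Euc d => Real.exp (-‖x‖ ^ 2 / 2))
      (-(Real.exp (-‖x‖ ^ 2 / 2)) • innerSL ℝ x) x := by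
    intro x
    have h := (((hasStrictFDerivAt_norm_sq x).hasFDerivAt.neg).mul_const (1 / 2 : ℝ)).exp
    simp only [mul_one_div] at h
    refine h.congr_fderiv ?_
    ext v
    simp
  have hdw : ∀ x : Euc d, fderiv ℝ (fun x : Euc d => Real.exp (-‖x‖ ^ 2 / 2)) x
      (EuclideanSpace.single i 1) = -(Real.exp (-‖x‖ ^ 2 / 2) * x i) := by
    intro x
    rw [(hw x).fderiv]
    simp [EuclideanSpace.inner_single_right]
  have hdP : ∀ x : Euc d, fderiv ℝ (fun x : Euc d => eval (fun i => x i) P) x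
      (EuclideanSpace.single i 1) = eval (fun i => x i) (pderiv i P) := by
    intro x
    rw [(hasFDerivAt_eval P x).fderiv]
    simp [PiLp.single_apply]
  have hXP : (X i * P).IsHomogeneous (1 + N) := (isHomogeneous_X ℝ i).mul hP
  have h := integral_mul_fderiv_eq_neg_fderiv_mul_of_integrable (μ := (volume : Measure (Euc d)))
    (f := fun x : Euc d => eval (fun i => x i) P) (g := fun x : Euc d => Real.exp (-‖x‖ ^ 2 / 2))
    (v := EuclideanSpace.single i 1) ?_ ?_ (integrable_and_integral_gaussian hd hP).1
    (fun x _ => (hasFDerivAt_eval P x).differentiableAt) (fun x _ => (hw x).differentiableAt)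
  · simp only [hdw, hdP, mul_neg, integral_neg, neg_inj] at h
    rw [← h]
    refine integral_congr_ae (Eventually.of_forall fun x => ?_)
    simp
    ring
  · simp only [hdP]
    exact (integrable_and_integral_gaussian hd hP.pderiv).1
  · simp only [hdw]
    refine ((integrable_and_integral_gaussian hd hXP).1.neg).congr
      (Eventually.of_forall fun x => ?_)
    simp
    ring

/-! ### Solid harmonics -/

variable {d : ℕ}

/-- The homogeneous harmonic polynomials of degree `n`. -/
noncomputable abbrev solid (d n : ℕ) : Submodule ℝ (MvPolynomial (Fin d) ℝ) :=
  homogeneousSubmodule (Fin d) ℝ n ⊓ LinearMap.ker (laplacian d)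

theorem mem_solid {n : ℕ} {P : MvPolynomial (Fin d) ℝ} :
    P ∈ solid d n ↔ P.IsHomogeneous n ∧ laplacian d P = 0 := Iff.rfl

theorem laplacian_apply (P : MvPolynomial (Fin d) ℝ) :
    laplacian d P = ∑ i, pderiv i (pderiv i P) := by
  simp [laplacian]

theorem laplacian_mul (P Q : MvPolynomial (Fin d) ℝ) :
    laplacian d (P * Q) =
      P * laplacian d Q + 2 * ∑ i, pderiv i P * pderiv i Q + Q * laplacian d P := by
  simp only [laplacian_apply, Finset.mul_sum, ← Finset.sum_add_distrib]
  refine Finset.sum_congr rfl fun i _ => ?_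
  simp only [Derivation.leibniz, map_add, smul_eq_mul]
  ring

/-- The derivative in the direction `e`. -/
noncomputable def dirDeriv (e : Fin d → ℝ) :
    Derivation ℝ (MvPolynomial (Fin d) ℝ) (MvPolynomial (Fin d) ℝ) :=
  ∑ i, e i • pderiv i

/-- The linear form `⟨x, e⟩`. -/
noncomputable def linForm (e : Fin d → ℝ) : MvPolynomial (Fin d) ℝ := ∑ i, C (e i) * X i

/-- The polynomial `|x|²`. -/
noncomputable def normSqPoly (d : ℕ) : MvPolynomial (Fin d) ℝ := ∑ i, X i ^ 2

theorem dirDeriv_apply (e : Fin d → ℝ) (P : MvPolynomial (Fin d) ℝ) :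
    dirDeriv e P = ∑ i, C (e i) * pderiv i P := by
  have : ∀ s : Finset (Fin d), (∑ i ∈ s, e i • pderiv i :
      Derivation ℝ (MvPolynomial (Fin d) ℝ) (MvPolynomial (Fin d) ℝ)) P =
      ∑ i ∈ s, C (e i) * pderiv i P := by
    intro s
    induction s using Finset.induction_on with
    | empty => simp
    | insert i s hi ih =>
      rw [Finset.sum_insert hi, Finset.sum_insert hi, Derivation.add_apply, ih,
        Derivation.smul_apply, smul_eq_C_mul]
  exact this _

theorem pderiv_linForm (e : Fin d → ℝ) (i : Fin d) : pderiv i (linForm e) = C (e i) := by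
  simp [linForm, pderiv_X, Pi.single_apply]

theorem pderiv_normSqPoly (i : Fin d) : pderiv i (normSqPoly d) = 2 * X i := by
  simp [normSqPoly, Derivation.leibniz_pow, pderiv_X, Pi.single_apply]

theorem dirDeriv_linForm (e : Fin d → ℝ) (he : ∑ i, e i ^ 2 = 1) : dirDeriv e (linForm e) = 1 := by
  simp only [dirDeriv_apply, pderiv_linForm, ← pow_two, ← C_pow]
  rw [← map_sum, he, C_1]

theorem dirDeriv_normSqPoly (e : Fin d → ℝ) : dirDeriv e (normSqPoly d) = 2 * linForm e := by
  simp only [dirDeriv_apply, pderiv_normSqPoly, linForm, Finset.mul_sum]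
  exact Finset.sum_congr rfl fun i _ => by ring

theorem isHomogeneous_linForm (e : Fin d → ℝ) : (linForm e).IsHomogeneous 1 :=
  IsHomogeneous.sum _ _ _ fun i _ => isHomogeneous_C_mul_X _ i

theorem isHomogeneous_normSqPoly : (normSqPoly d).IsHomogeneous 2 :=
  IsHomogeneous.sum _ _ _ fun i _ => isHomogeneous_X_pow i 2

theorem isHomogeneous_dirDeriv {e : Fin d → ℝ} {n : ℕ} {P : MvPolynomial (Fin d) ℝ}
    (hP : P.IsHomogeneous n) : (dirDeriv e P).IsHomogeneous (n - 1) := by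
  rw [dirDeriv_apply]
  exact IsHomogeneous.sum _ _ _ fun i _ => by simpa using (isHomogeneous_C _ (e i)).mul hP.pderiv

theorem pderiv_eq_zero_of_isHomogeneous_zero {P : MvPolynomial (Fin d) ℝ}
    (hP : P.IsHomogeneous 0) (i : Fin d) : pderiv i P = 0 := by
  rw [← totalDegree_zero_iff_isHomogeneous, totalDegree_eq_zero_iff_eq_C] at hP
  rw [hP, pderiv_C]

theorem dirDeriv_eq_zero_of_isHomogeneous_zero {P : MvPolynomial (Fin d) ℝ}
    (hP : P.IsHomogeneous 0) (e : Fin d → ℝ) : dirDeriv e P = 0 := by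
  simp [dirDeriv_apply, pderiv_eq_zero_of_isHomogeneous_zero hP]

/-- The commutator is again a derivation, and it kills every variable. -/
theorem pderiv_comm (i j : Fin d) (P : MvPolynomial (Fin d) ℝ) :
    pderiv i (pderiv j P) = pderiv j (pderiv i P) := by
  have h : ⁅(pderiv i : Derivation ℝ (MvPolynomial (Fin d) ℝ) (MvPolynomial (Fin d) ℝ)),
      (pderiv j : Derivation ℝ (MvPolynomial (Fin d) ℝ) (MvPolynomial (Fin d) ℝ))⁆ = 0 := by
    refine MvPolynomial.derivation_ext (R := ℝ) (σ := Fin d) fun k => ?_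
    simp [Derivation.commutator_apply, pderiv_X, Pi.single_apply, apply_ite]
  have := congrArg (fun D => D P) h
  simpa [Derivation.commutator_apply, sub_eq_zero] using this

theorem laplacian_dirDeriv (e : Fin d → ℝ) (P : MvPolynomial (Fin d) ℝ) :
    laplacian d (dirDeriv e P) = dirDeriv e (laplacian d P) := by
  simp only [dirDeriv_apply, laplacian_apply, map_sum, ← smul_eq_C_mul,
    map_smul, Finset.smul_sum]
  rw [Finset.sum_comm]
  refine Finset.sum_congr rfl fun i _ => Finset.sum_congr rfl fun j _ => ?_
  rw [pderiv_comm j i, pderiv_comm j i]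

theorem laplacian_linForm_mul (e : Fin d → ℝ) (P : MvPolynomial (Fin d) ℝ) :
    laplacian d (linForm e * P) = linForm e * laplacian d P + 2 * dirDeriv e P := by
  rw [laplacian_mul, dirDeriv_apply]
  simp [pderiv_linForm, laplacian_apply (linForm e)]

theorem laplacian_normSqPoly_mul {n : ℕ} {P : MvPolynomial (Fin d) ℝ} (hP : P.IsHomogeneous n) :
    laplacian d (normSqPoly d * P) =
      normSqPoly d * laplacian d P + C (4 * (n : ℝ) + 2 * d) * P := by
  have h1 : laplacian d (normSqPoly d) = C (2 * (d : ℝ)) := by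
    rw [laplacian_apply]
    have : ∀ i : Fin d, pderiv i (2 * X i : MvPolynomial (Fin d) ℝ) = 2 := fun i => by
      rw [← map_ofNat C 2, pderiv_C_mul, pderiv_X_self, mul_one]
    simp only [pderiv_normSqPoly, this, C_mul, map_ofNat, Finset.sum_const, Finset.card_univ,
      Fintype.card_fin, nsmul_eq_mul, map_natCast]
    ring
  have h2 : ∑ i, pderiv i (normSqPoly d) * pderiv i P =
      (C (2 * (n : ℝ)) : MvPolynomial (Fin d) ℝ) * P := by
    simp only [pderiv_normSqPoly, mul_assoc, ← Finset.mul_sum, hP.sum_X_mul_pderiv]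
    simp only [C_mul, map_ofNat, map_natCast, nsmul_eq_mul, mul_assoc]
  rw [laplacian_mul, h1, h2]
  simp only [C_mul, C_add, map_ofNat]
  ring

/-- The lowering map `∂_e P / (2 m + d - 2)` on solid harmonics of degree `m`. -/
noncomputable def lower (e : Fin d → ℝ) (m : ℕ) (P : MvPolynomial (Fin d) ℝ) :
    MvPolynomial (Fin d) ℝ := C (2 * (m : ℝ) + d - 2)⁻¹ * dirDeriv e P

/-- The harmonic part of degree `m + 1` of `⟨x, e⟩ P`, for a solid harmonic `P` of degree `m`. -/
noncomputable def raise (e : Fin d → ℝ) (m : ℕ) (P : MvPolynomial (Fin d) ℝ) :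
    MvPolynomial (Fin d) ℝ := linForm e * P - normSqPoly d * lower e m P

theorem lower_zero_of_isHomogeneous {e : Fin d → ℝ} {m : ℕ} {P : MvPolynomial (Fin d) ℝ}
    (hP : P.IsHomogeneous 0) : lower e m P = 0 := by
  rw [lower, dirDeriv_eq_zero_of_isHomogeneous_zero hP, mul_zero]

/-- The factor `2m + d - 2` vanishes only for `m = 0`, `d = 2`. There the default inverse `0` is
harmless, because the derivative of a constant is `0`. -/
theorem dirDeriv_eq_lower (hd : 2 ≤ d) {e : Fin d → ℝ} {m : ℕ} {P : MvPolynomial (Fin d) ℝ}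
    (hP : P.IsHomogeneous m) : dirDeriv e P = C (2 * (m : ℝ) + d - 2) * lower e m P := by
  have hd' : (2 : ℝ) ≤ d := by exact_mod_cast hd
  rcases Nat.eq_zero_or_pos m with rfl | hm
  · rw [lower_zero_of_isHomogeneous hP, dirDeriv_eq_zero_of_isHomogeneous_zero hP, mul_zero]
  · have hm' : (1 : ℝ) ≤ m := by exact_mod_cast hm
    rw [lower, ← mul_assoc, ← C_mul, mul_inv_cancel₀ (by linarith), C_1, one_mul]

theorem lower_mem_solid {e : Fin d → ℝ} {m : ℕ} {P : MvPolynomial (Fin d) ℝ}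
    (hP : P ∈ solid d m) : lower e m P ∈ solid d (m - 1) := by
  rw [lower, ← smul_eq_C_mul]
  refine Submodule.smul_mem _ _ (mem_solid.2 ⟨isHomogeneous_dirDeriv (mem_solid.1 hP).1, ?_⟩)
  rw [laplacian_dirDeriv, (mem_solid.1 hP).2, map_zero]

/-- `Δ(⟨x,e⟩ P) = 2 ∂_e P`, and the constant in `lower` is chosen so that `Δ(|x|² lower P)` equals
the same polynomial. -/
theorem raise_mem_solid (hd : 2 ≤ d) {e : Fin d → ℝ} {m : ℕ} {P : MvPolynomial (Fin d) ℝ}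
    (hP : P ∈ solid d m) : raise e m P ∈ solid d (m + 1) := by
  have hL := mem_solid.1 (lower_mem_solid (e := e) hP)
  have hP' := mem_solid.1 hP
  refine mem_solid.2 ⟨?_, ?_⟩
  · refine IsHomogeneous.sub ?_ ?_
    · simpa [add_comm] using (isHomogeneous_linForm e).mul hP'.1
    · rcases Nat.eq_zero_or_pos m with rfl | hm
      · rw [lower_zero_of_isHomogeneous hP'.1, mul_zero]
        exact isHomogeneous_zero _ _ _
      · have := isHomogeneous_normSqPoly.mul hL.1
        rwa [show 2 + (m - 1) = m + 1 by omega] at this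
  · rw [raise, map_sub, laplacian_linForm_mul, hP'.2, laplacian_normSqPoly_mul hL.1, hL.2,
      dirDeriv_eq_lower hd hP'.1]
    rcases Nat.eq_zero_or_pos m with rfl | hm
    · simp [lower_zero_of_isHomogeneous hP'.1]
    · have : (4 * ((m - 1 : ℕ) : ℝ) + 2 * d) = 2 * (2 * (m : ℝ) + d - 2) := by
        rw [Nat.cast_sub hm]; push_cast; ring
      rw [this, C_mul, map_ofNat]
      ring

/-- This commutation relation is the source of the recursion defining `coefSq`. -/
theorem lower_raise (hd : 2 ≤ d) {e : Fin d → ℝ} (he : ∑ i, e i ^ 2 = 1) {m : ℕ}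
    {P : MvPolynomial (Fin d) ℝ} (hP : P ∈ solid d m) :
    lower e (m + 1) (raise e m P) =
      C (2 * (m : ℝ) + d)⁻¹ * (P + C (2 * (m : ℝ) + d - 4) * raise e (m - 1) (lower e m P)) := by
  have hL := mem_solid.1 (lower_mem_solid (e := e) hP)
  have h1 := dirDeriv_eq_lower hd (e := e) (mem_solid.1 hP).1
  have h2 : dirDeriv e (lower e m P) =
      C (2 * (m : ℝ) + d - 4) * lower e (m - 1) (lower e m P) := by
    rcases Nat.eq_zero_or_pos m with rfl | hm
    · rw [lower_zero_of_isHomogeneous (mem_solid.1 hP).1, map_zero, lower, map_zero, mul_zero,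
        mul_zero]
    · rw [dirDeriv_eq_lower hd hL.1, Nat.cast_sub hm]
      congr 2
      push_cast
      ring
  have h3 : (C (2 * (m : ℝ) + d - 2) : MvPolynomial (Fin d) ℝ) =
      C (2 * (m : ℝ) + d - 4) + 2 := by
    rw [← map_ofNat C 2, ← C_add]
    congr 1
    ring
  have h4 : 2 * ((m + 1 : ℕ) : ℝ) + d - 2 = 2 * m + d := by push_cast; ring
  rw [lower, raise, map_sub, Derivation.leibniz, Derivation.leibniz, dirDeriv_linForm e he,
    dirDeriv_normSqPoly, h2, h1, h3, h4, raise]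
  simp only [smul_eq_mul]
  ring

/-! ### Orthogonality and completeness of the spherical harmonics -/

theorem restrict_mul (P Q : MvPolynomial (Fin d) ℝ) :
    restrict d (P * Q) = restrict d P * restrict d Q := by
  ext x
  simp [restrict]

theorem restrict_one : restrict d 1 = 1 := by
  ext x
  simp [restrict]

theorem restrict_linForm (e : Euc d) (x : Sph d) :
    restrict d (linForm e) x = inner ℝ (x : Euc d) e := by
  simp [restrict, linForm, PiLp.inner_apply]

theorem restrict_normSqPoly : restrict d (normSqPoly d) = 1 := by
  ext x
  have h : ‖(x : Euc d)‖ ^ 2 = 1 := by simp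
  rw [EuclideanSpace.norm_sq_eq] at h
  simpa [restrict, normSqPoly] using h

theorem restrict_raise_add_lower (e : Fin d → ℝ) (m : ℕ) (P : MvPolynomial (Fin d) ℝ) :
    restrict d (raise e m P) + restrict d (lower e m P) = restrict d (linForm e * P) := by
  rw [raise, map_sub, restrict_mul (normSqPoly d), restrict_normSqPoly, one_mul, sub_add_cancel]

theorem isHomogeneous_mul_pderiv {n m : ℕ} {P Q : MvPolynomial (Fin d) ℝ}
    (hP : P.IsHomogeneous n) (hQ : Q.IsHomogeneous m) (i : Fin d) :
    (P * pderiv i Q).IsHomogeneous (n + m - 1) := by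
  rcases Nat.eq_zero_or_pos m with rfl | hm
  · rw [pderiv_eq_zero_of_isHomogeneous_zero hQ, mul_zero]
    exact isHomogeneous_zero _ _ _
  · rw [Nat.add_sub_assoc hm]
    exact hP.mul hQ.pderiv

/-- Green's argument with Gaussian weight: the field `R = P∇Q - Q∇P` has divergence `PΔQ - QΔP = 0`,
while Euler's identity gives `x · R = (m - n) P Q`. Integration by parts equates the integrals of `x
· R` and `div R`. -/
theorem integral_restrict_mul_eq_zero (hd : 1 ≤ d) {n m : ℕ} (hnm : n ≠ m)
    {P Q : MvPolynomial (Fin d) ℝ} (hP : P ∈ solid d n) (hQ : Q ∈ solid d m) :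
    ∫ x, restrict d (P * Q) x ∂surf d = 0 := by
  rw [mem_solid] at hP hQ
  set R : Fin d → MvPolynomial (Fin d) ℝ := fun i => P * pderiv i Q - Q * pderiv i P
  have hR : ∀ i, (R i).IsHomogeneous (n + m - 1) := fun i =>
    (isHomogeneous_mul_pderiv hP.1 hQ.1 i).sub
      (by rw [add_comm]; exact isHomogeneous_mul_pderiv hQ.1 hP.1 i)
  have h1 : ∑ i, X i * R i = ((m : MvPolynomial (Fin d) ℝ) - n) * (P * Q) := by
    have e : ∑ i, X i * R i = P * ∑ i, X i * pderiv i Q - Q * ∑ i, X i * pderiv i P := by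
      simp only [Finset.mul_sum, ← Finset.sum_sub_distrib]
      exact Finset.sum_congr rfl fun i _ => by ring
    rw [e, hP.1.sum_X_mul_pderiv, hQ.1.sum_X_mul_pderiv]
    simp only [nsmul_eq_mul]
    ring
  have h2 : ∑ i, pderiv i (R i) = 0 := by
    have e : ∑ i, pderiv i (R i) = P * laplacian d Q - Q * laplacian d P := by
      simp only [laplacian_apply, Finset.mul_sum, ← Finset.sum_sub_distrib, R]
      refine Finset.sum_congr rfl fun i _ => ?_
      simp only [map_sub, Derivation.leibniz, smul_eq_mul]
      ring
    rw [e, hP.2, hQ.2, mul_zero, mul_zero, sub_zero]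
  have hPQ := integrable_and_integral_gaussian hd (hP.1.mul hQ.1)
  have h3 : ∑ i, ∫ x : Euc d, eval (fun i => x i) (X i * R i) * Real.exp (-‖x‖ ^ 2 / 2) =
      ∑ i, ∫ x : Euc d, eval (fun i => x i) (pderiv i (R i)) * Real.exp (-‖x‖ ^ 2 / 2) :=
    Finset.sum_congr rfl fun i _ => gaussian_integral_X_mul hd (hR i) i
  rw [← integral_finsetSum _ fun i _ => (integrable_and_integral_gaussian hd
      ((isHomogeneous_X ℝ i).mul (hR i))).1,
    ← integral_finsetSum _ fun i _ => (integrable_and_integral_gaussian hd (hR i).pderiv).1] at h3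
  simp only [← Finset.sum_mul, ← map_sum, h1, h2, map_zero, zero_mul, integral_zero] at h3
  simp only [map_mul, map_sub, map_natCast, mul_assoc] at h3
  rw [integral_const_mul] at h3
  have hne : ((m : ℝ) - n) ≠ 0 := sub_ne_zero.2 (by exact_mod_cast hnm.symm)
  have h4 := (mul_eq_zero.1 h3).resolve_left hne
  have h5 := hPQ.2
  simp only [map_mul, mul_assoc] at h5
  rw [h4] at h5
  have := (mul_eq_zero.1 h5.symm).resolve_right (radialMoment_pos _ _).ne'
  exact this

/-- The class in `L²(S^{d-1})` of the restriction of a polynomial to the sphere. -/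
noncomputable def sph (d : ℕ) : MvPolynomial (Fin d) ℝ →ₗ[ℝ] L2 d :=
  (ContinuousMap.toLp (E := ℝ) 2 (surf d) ℝ).toLinearMap ∘ₗ restrict d

theorem sph_mem_harmonics {n : ℕ} {P : MvPolynomial (Fin d) ℝ} (hP : P ∈ solid d n) :
    sph d P ∈ harmonics d n := Submodule.mem_map_of_mem hP

theorem coeFn_sph (P : MvPolynomial (Fin d) ℝ) : sph d P =ᵐ[surf d] restrict d P :=
  ContinuousMap.coeFn_toLp (surf d) (restrict d P)

theorem inner_sph_right (f : L2 d) (P : MvPolynomial (Fin d) ℝ) :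
    inner ℝ f (sph d P) = ∫ x, f x * restrict d P x ∂surf d := by
  rw [L2.inner_def]
  refine integral_congr_ae ?_
  filter_upwards [coeFn_sph P] with x hx
  rw [hx]
  simp [mul_comm]

theorem inner_sph_sph (P Q : MvPolynomial (Fin d) ℝ) :
    inner ℝ (sph d P) (sph d Q) = ∫ x, restrict d (P * Q) x ∂surf d := by
  rw [inner_sph_right]
  refine integral_congr_ae ?_
  filter_upwards [coeFn_sph P] with x hx
  rw [hx, restrict_mul]
  rfl

theorem inner_eq_zero_of_mem_harmonics (hd : 1 ≤ d) {n m : ℕ} (hnm : n ≠ m) {f g : L2 d}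
    (hf : f ∈ harmonics d n) (hg : g ∈ harmonics d m) : inner ℝ f g = 0 := by
  obtain ⟨P, hP, rfl⟩ := hf
  obtain ⟨Q, hQ, rfl⟩ := hg
  exact (inner_sph_sph P Q).trans (integral_restrict_mul_eq_zero hd hnm hP hQ)

theorem orthogonalFamily_harmonics (hd : 1 ≤ d) :
    OrthogonalFamily ℝ (fun n => harmonics d n) fun n => (harmonics d n).subtypeₗᵢ :=
  fun _ _ hnm f g => inner_eq_zero_of_mem_harmonics hd hnm f.2 g.2

/-- The span of the spherical harmonics of degree at most `k`. -/
noncomputable def harmonicsUpTo (d k : ℕ) : Submodule ℝ (L2 d) := ⨆ n ≤ k, harmonics d n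

theorem harmonics_le_harmonicsUpTo {n k : ℕ} (h : n ≤ k) : harmonics d n ≤ harmonicsUpTo d k :=
  le_iSup₂_of_le n h le_rfl

theorem harmonicsUpTo_mono {k l : ℕ} (h : k ≤ l) : harmonicsUpTo d k ≤ harmonicsUpTo d l :=
  iSup₂_le fun _ hn => harmonics_le_harmonicsUpTo (hn.trans h)

theorem sph_linForm_mul (e : Fin d → ℝ) (m : ℕ) (P : MvPolynomial (Fin d) ℝ) :
    sph d (linForm e * P) = sph d (raise e m P) + sph d (lower e m P) := by
  rw [← map_add]
  simp only [sph, LinearMap.comp_apply]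
  rw [← restrict_raise_add_lower e m P, map_add (restrict d)]

/-- Multiplication by `⟨x, e⟩` on `L²(S^{d-1})`. -/
noncomputable def mulLin (e : Fin d → ℝ) : L2 d →L[ℝ] L2 d :=
  (ContinuousLinearMap.mul ℝ ℝ).holderL (surf d) ⊤ 2 2
    (ContinuousMap.toLp (E := ℝ) ⊤ (surf d) ℝ (restrict d (linForm e)))

theorem coeFn_mulLin (e : Fin d → ℝ) (f : L2 d) :
    mulLin e f =ᵐ[surf d] fun x => restrict d (linForm e) x * f x := by
  have h := (ContinuousLinearMap.mul ℝ ℝ).coeFn_holder (r := 2)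
    (ContinuousMap.toLp (E := ℝ) ⊤ (surf d) ℝ (restrict d (linForm e))) f
  have h' := ContinuousMap.coeFn_toLp (p := ⊤) (𝕜 := ℝ) (surf d) (restrict d (linForm e))
  filter_upwards [h, h'] with x hx hx'
  rw [← hx']
  exact hx

theorem mulLin_sph (e : Fin d → ℝ) (P : MvPolynomial (Fin d) ℝ) :
    mulLin e (sph d P) = sph d (linForm e * P) := by
  refine Lp.ext ?_
  filter_upwards [coeFn_mulLin e (sph d P), coeFn_sph P, coeFn_sph (linForm e * P)]
    with x h1 h2 h3
  rw [h1, h2, h3, restrict_mul]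
  rfl

theorem inner_mulLin (e : Fin d → ℝ) (f g : L2 d) :
    inner ℝ (mulLin e f) g = ∫ x, restrict d (linForm e) x * (f x * g x) ∂surf d := by
  rw [L2.inner_def]
  refine integral_congr_ae ?_
  filter_upwards [coeFn_mulLin e f] with x hx
  rw [hx]
  simp
  ring

theorem inner_mulLin_comm (e : Fin d → ℝ) (f g : L2 d) :
    inner ℝ (mulLin e f) g = inner ℝ (mulLin e g) f := by
  simp only [inner_mulLin, mul_comm]

theorem mulLin_mem_harmonicsUpTo (hd : 2 ≤ d) (e : Fin d → ℝ) {k : ℕ} {f : L2 d}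
    (hf : f ∈ harmonicsUpTo d k) : mulLin e f ∈ harmonicsUpTo d (k + 1) := by
  have h : harmonicsUpTo d k ≤ (harmonicsUpTo d (k + 1)).comap (mulLin e).toLinearMap := by
    refine iSup₂_le fun n hn => ?_
    rintro _ ⟨P, hP, rfl⟩
    change mulLin e (sph d P) ∈ harmonicsUpTo d (k + 1)
    rw [mulLin_sph, sph_linForm_mul e n P]
    exact Submodule.add_mem _
      (harmonics_le_harmonicsUpTo (by omega) (sph_mem_harmonics (raise_mem_solid hd hP)))
      (harmonics_le_harmonicsUpTo (by omega) (sph_mem_harmonics (lower_mem_solid hP)))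
  exact h hf

theorem linForm_single (i : Fin d) : linForm (Pi.single i 1) = X i := by
  simp [linForm, Pi.single_apply]

theorem C_mem_solid (a : ℝ) : C a ∈ solid d 0 :=
  mem_solid.2 ⟨isHomogeneous_C _ _, by simp [laplacian_apply]⟩

/-- A monomial is built by multiplying by one coordinate at a time, and each multiplication raises
the degree of the harmonics involved by at most one. -/
theorem sph_monomial_mem (hd : 2 ≤ d) (m : Fin d →₀ ℕ) (a : ℝ) :
    sph d (monomial m a) ∈ harmonicsUpTo d m.degree := by
  induction hk : m.degree generalizing m with
  | zero =>
    rw [Finsupp.degree_eq_zero_iff] at hk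
    subst hk
    exact harmonics_le_harmonicsUpTo (Nat.zero_le _) (sph_mem_harmonics (C_mem_solid a))
  | succ k ih =>
    obtain ⟨i, hi⟩ : ∃ i, m i ≠ 0 := by
      by_contra! h
      simp [(Finsupp.ext h : m = 0)] at hk
    have hm := Finsupp.sub_add_single_one_cancel hi
    have hk' : (m - Finsupp.single i 1).degree = k := by
      rw [← hm, map_add, Finsupp.degree_single] at hk
      omega
    rw [← hm, monomial_add_single, pow_one, mul_comm, ← linForm_single, ← mulLin_sph]
    exact mulLin_mem_harmonicsUpTo hd _ (ih _ hk')

theorem sph_mem_harmonicsUpTo (hd : 2 ≤ d) {k : ℕ} {P : MvPolynomial (Fin d) ℝ}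
    (hP : P.totalDegree ≤ k) : sph d P ∈ harmonicsUpTo d k := by
  rw [P.as_sum, map_sum]
  refine Submodule.sum_mem _ fun m hm => ?_
  refine harmonicsUpTo_mono ?_ (sph_monomial_mem hd m _)
  refine le_trans ?_ ((le_totalDegree hm).trans hP)
  rw [Finsupp.degree_eq_sum, Finsupp.sum_fintype _ _ (by simp)]

/-- Stone–Weierstrass for restricted polynomials, followed by density of continuous functions in
`L²`. -/
theorem dense_harmonics (hd : 2 ≤ d) : ⊤ ≤ (⨆ n, harmonics d n).topologicalClosure := by
  let A : MvPolynomial (Fin d) ℝ →ₐ[ℝ] C(Sph d, ℝ) :=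
    AlgHom.ofLinearMap (restrict d) restrict_one restrict_mul
  have hsep : A.range.SeparatesPoints := by
    intro x y hxy
    obtain ⟨i, hi⟩ : ∃ i, (x : Euc d) i ≠ (y : Euc d) i := by
      by_contra! h
      exact hxy (Subtype.ext (PiLp.ext h))
    refine ⟨_, ⟨A (X i), ⟨X i, rfl⟩, rfl⟩, ?_⟩
    simpa [A, restrict] using hi
  have h1 := ContinuousMap.subalgebra_topologicalClosure_eq_top_of_separatesPoints A.range hsep
  have h2 : (LinearMap.range (restrict d)).topologicalClosure = ⊤ := by
    have := congrArg Subalgebra.toSubmodule h1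
    exact this
  have h3 := (ContinuousMap.toLp_denseRange (p := 2) ℝ (surf d) ℝ
    (by norm_num)).topologicalClosure_map_submodule h2
  rw [← h3]
  refine Submodule.topologicalClosure_mono ?_
  rintro _ ⟨_, ⟨P, rfl⟩, rfl⟩
  have h4 : harmonicsUpTo d P.totalDegree ≤ ⨆ n, harmonics d n :=
    iSup₂_le fun n _ => le_iSup (harmonics d) n
  exact h4 (sph_mem_harmonicsUpTo hd le_rfl)

/-! ### Multiplication by `⟨x, e⟩` between consecutive degrees -/

/-- The square of the norm of the map `f ↦ proj_n (⟨x, e⟩ f)` on the spherical harmonics of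
degree `n - 1`. -/
noncomputable def coefSq (d : ℕ) : ℕ → ℝ
  | 0 => 0
  | m + 1 => (1 + (2 * (m : ℝ) + d - 4) * coefSq d m) / (2 * (m : ℝ) + d)

theorem coefSq_succ (d m : ℕ) :
    coefSq d (m + 1) = (1 + (2 * (m : ℝ) + d - 4) * coefSq d m) / (2 * (m : ℝ) + d) := rfl

theorem coefSq_pos (hd : 2 ≤ d) (m : ℕ) : 0 < coefSq d (m + 1) := by
  have hd' : (2 : ℝ) ≤ d := by exact_mod_cast hd
  induction m with
  | zero =>
    rw [coefSq_succ, coefSq, mul_zero, add_zero]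
    positivity
  | succ m ih =>
    rw [coefSq_succ]
    have : 0 ≤ 2 * ((m + 1 : ℕ) : ℝ) + d - 4 := by
      push_cast
      have : (0 : ℝ) ≤ m := Nat.cast_nonneg m
      linarith
    positivity

/-- The closed form starts at index `2`: at index `1` it would read `0/0` when `d = 2`, whereas
`coefSq d 1 = 1/d`. -/
theorem coefSq_add_two (hd : 2 ≤ d) (n : ℕ) :
    coefSq d (n + 2) = (n + 2) * (n + d - 1) / ((2 * n + d) * (2 * n + 2 + d)) := by
  have hd' : (2 : ℝ) ≤ d := by exact_mod_cast hd
  have hd0 : (d : ℝ) ≠ 0 := by linarith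
  induction n with
  | zero =>
    rw [coefSq_succ, coefSq_succ, coefSq]
    push_cast
    field_simp
    ring
  | succ n ih =>
    have h0 : (0 : ℝ) ≤ n := Nat.cast_nonneg n
    have h1 : 2 * (n : ℝ) + d ≠ 0 := by positivity
    have h2 : 2 * (n : ℝ) + 2 + d ≠ 0 := by positivity
    have h3 : 2 * ((n : ℝ) + 1) + 2 + d ≠ 0 := by positivity
    have h4 : 2 * ((n : ℝ) + 2) + d ≠ 0 := by positivity
    have h5 : 2 * ((n : ℝ) + 1) + d ≠ 0 := by positivity
    rw [coefSq_succ, ih]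
    push_cast
    have e : 2 * ((n : ℝ) + 2) + d - 4 = 2 * n + d := by ring
    have h6 : (2 * (n : ℝ) + d) * ((n + 2) * (n + d - 1) / ((2 * n + d) * (2 * n + 2 + d))) =
        (n + 2) * (n + d - 1) / (2 * n + 2 + d) := by
      field_simp
    rw [e, h6]
    field_simp
    ring

theorem alpha_mul_alpha_succ_sq (hd : 2 ≤ d) {n : ℕ} (hn : 1 ≤ n) :
    (alpha (((d : ℝ) - 2) / 2) n * alpha (((d : ℝ) - 2) / 2) (n + 1)) ^ 2 =
      4 * coefSq d (n + 1) := by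
  have hd' : (2 : ℝ) ≤ d := by exact_mod_cast hd
  have hl : 0 ≤ ((d : ℝ) - 2) / 2 := by linarith
  obtain ⟨k, rfl⟩ : ∃ k, n = k + 1 := ⟨n - 1, by omega⟩
  have h0 : (0 : ℝ) ≤ k := Nat.cast_nonneg k
  have h1 : 2 * (k : ℝ) + d ≠ 0 := by positivity
  have h2 : 2 * (k : ℝ) + 2 + d ≠ 0 := by positivity
  have h3 : (k : ℝ) + 1 + ((d : ℝ) - 2) / 2 ≠ 0 := by positivity
  have h4 : (k : ℝ) + 1 + 1 + ((d : ℝ) - 2) / 2 ≠ 0 := by positivity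
  rw [mul_pow, alpha_sq_mul_alpha_sq hl hn, coefSq_add_two hd]
  push_cast
  have e1 : 2 * (k : ℝ) + d = 2 * (k + 1 + (d - 2) / 2) := by ring
  have e2 : 2 * (k : ℝ) + 2 + d = 2 * (k + 1 + 1 + (d - 2) / 2) := by ring
  rw [e1, e2]
  field_simp
  ring

theorem inner_sph_raise (hd : 2 ≤ d) (e : Fin d → ℝ) {m : ℕ} {P Q : MvPolynomial (Fin d) ℝ}
    (hP : P ∈ solid d m) (hQ : Q ∈ solid d (m + 1)) :
    inner ℝ (mulLin e (sph d P)) (sph d Q) = inner ℝ (sph d (raise e m P)) (sph d Q) := by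
  rw [mulLin_sph, sph_linForm_mul e m, inner_add_left,
    inner_eq_zero_of_mem_harmonics (by omega) (by omega : m - 1 ≠ m + 1)
      (sph_mem_harmonics (lower_mem_solid hP)) (sph_mem_harmonics hQ), add_zero]

/-- Together with `inner_sph_raise` this says that `raise` and `lower` are adjoint on the sphere. -/
theorem inner_sph_lower (hd : 2 ≤ d) (e : Fin d → ℝ) {m : ℕ} {P Q : MvPolynomial (Fin d) ℝ}
    (hP : P ∈ solid d m) (hQ : Q ∈ solid d (m + 1)) :
    inner ℝ (mulLin e (sph d P)) (sph d Q) =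
      inner ℝ (sph d P) (sph d (lower e (m + 1) Q)) := by
  rw [inner_mulLin_comm, mulLin_sph, sph_linForm_mul e (m + 1), inner_add_left,
    inner_eq_zero_of_mem_harmonics (by omega) (by omega : m + 1 + 1 ≠ m)
      (sph_mem_harmonics (raise_mem_solid hd hQ)) (sph_mem_harmonics hP), zero_add,
    real_inner_comm]

theorem sph_C_mul (a : ℝ) (P : MvPolynomial (Fin d) ℝ) : sph d (C a * P) = a • sph d P := by
  rw [← smul_eq_C_mul, map_smul]

/-- By adjointness `‖raise P‖² = ⟨P, lower (raise P)⟩`, to which `lower_raise` applies. -/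
theorem norm_sph_raise_sq (hd : 2 ≤ d) {e : Fin d → ℝ} (he : ∑ i, e i ^ 2 = 1) {m : ℕ}
    {P : MvPolynomial (Fin d) ℝ} (hP : P ∈ solid d m) :
    ‖sph d (raise e m P)‖ ^ 2 =
      (‖sph d P‖ ^ 2 + (2 * (m : ℝ) + d - 4) * ‖sph d (lower e m P)‖ ^ 2) /
        (2 * (m : ℝ) + d) := by
  have hL : inner ℝ (sph d P) (sph d (raise e (m - 1) (lower e m P))) =
      ‖sph d (lower e m P)‖ ^ 2 := by
    rcases Nat.eq_zero_or_pos m with rfl | hm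
    · rw [lower_zero_of_isHomogeneous (mem_solid.1 hP).1]
      simp [raise, lower]
    · obtain ⟨k, rfl⟩ : ∃ k, m = k + 1 := ⟨m - 1, by omega⟩
      have hlow := lower_mem_solid (e := e) hP
      rw [Nat.add_sub_cancel] at hlow ⊢
      rw [real_inner_comm, ← inner_sph_raise hd e hlow hP, inner_sph_lower hd e hlow hP,
        real_inner_self_eq_norm_sq]
  have hR := raise_mem_solid hd (e := e) hP
  rw [← real_inner_self_eq_norm_sq, ← inner_sph_raise hd e hP hR, inner_sph_lower hd e hP hR,
    lower_raise hd he hP, sph_C_mul, map_add, sph_C_mul, inner_smul_right, inner_add_right,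
    inner_smul_right, hL, real_inner_self_eq_norm_sq, inv_mul_eq_div]

/-- An operator and its adjoint have the same norm. -/
theorem norm_sph_lower_sq_le (hd : 2 ≤ d) {e : Fin d → ℝ} {m : ℕ} {c : ℝ} (hc0 : 0 ≤ c)
    (hc : ∀ P ∈ solid d m, ‖sph d (raise e m P)‖ ^ 2 ≤ c * ‖sph d P‖ ^ 2)
    {P : MvPolynomial (Fin d) ℝ} (hP : P ∈ solid d (m + 1)) :
    ‖sph d (lower e (m + 1) P)‖ ^ 2 ≤ c * ‖sph d P‖ ^ 2 := by
  have hlow := lower_mem_solid (e := e) hP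
  rw [Nat.add_sub_cancel] at hlow
  have h1 := hc _ hlow
  have h2 : ‖sph d (lower e (m + 1) P)‖ ^ 2 ≤
      ‖sph d (raise e m (lower e (m + 1) P))‖ * ‖sph d P‖ := by
    rw [← real_inner_self_eq_norm_sq, ← inner_sph_lower hd e hlow hP, inner_sph_raise hd e hlow hP]
    exact real_inner_le_norm _ _
  set x := ‖sph d (lower e (m + 1) P)‖
  set y := ‖sph d (raise e m (lower e (m + 1) P))‖
  set p := ‖sph d P‖
  rcases (norm_nonneg (sph d (lower e (m + 1) P))).eq_or_lt' with hx | hx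
  · change x = 0 at hx
    rw [hx, zero_pow two_ne_zero]
    positivity
  · change 0 < x at hx
    have h3 : (x ^ 2) ^ 2 ≤ (y * p) ^ 2 := pow_le_pow_left₀ (sq_nonneg x) h2 2
    have h4 : (y * p) ^ 2 ≤ c * x ^ 2 * p ^ 2 := by
      rw [mul_pow]
      exact mul_le_mul_of_nonneg_right h1 (sq_nonneg p)
    have h5 : x ^ 2 * x ^ 2 ≤ x ^ 2 * (c * p ^ 2) := by nlinarith
    exact le_of_mul_le_mul_left h5 (by positivity)

/-- For degree at least `1` the coefficient `2m + d - 4` is nonnegative, so the bound for `lower`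
passes through `norm_sph_raise_sq`. In degree `0`, where it may be negative, `lower` vanishes. -/
theorem norm_sph_raise_sq_le (hd : 2 ≤ d) {e : Fin d → ℝ} (he : ∑ i, e i ^ 2 = 1) (m : ℕ) :
    ∀ P ∈ solid d m, ‖sph d (raise e m P)‖ ^ 2 ≤ coefSq d (m + 1) * ‖sph d P‖ ^ 2 := by
  have hd' : (2 : ℝ) ≤ d := by exact_mod_cast hd
  induction m with
  | zero =>
    intro P hP
    rw [norm_sph_raise_sq hd he hP, lower_zero_of_isHomogeneous (mem_solid.1 hP).1, coefSq_succ,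
      coefSq]
    simp [inv_mul_eq_div]
  | succ m ih =>
    intro P hP
    have h := norm_sph_lower_sq_le hd (coefSq_pos hd m).le ih hP
    have h0 : 0 ≤ 2 * ((m + 1 : ℕ) : ℝ) + d - 4 := by
      push_cast
      have : (0 : ℝ) ≤ m := Nat.cast_nonneg m
      linarith
    rw [norm_sph_raise_sq hd he hP, coefSq_succ, div_mul_eq_mul_div]
    refine div_le_div_of_nonneg_right ?_ (by positivity)
    rw [add_mul, one_mul, mul_assoc]
    gcongr

theorem inner_mulLin_le (hd : 2 ≤ d) {e : Fin d → ℝ} (he : ∑ i, e i ^ 2 = 1) {n : ℕ} {f g : L2 d}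
    (hf : f ∈ harmonics d n) (hg : g ∈ harmonics d (n + 1)) :
    inner ℝ (mulLin e f) g ≤ √(coefSq d (n + 1)) * (‖f‖ * ‖g‖) := by
  obtain ⟨P, hP, rfl⟩ := hf
  obtain ⟨Q, hQ, rfl⟩ := hg
  change inner ℝ (mulLin e (sph d P)) (sph d Q) ≤ _ * (‖sph d P‖ * ‖sph d Q‖)
  rw [inner_sph_raise hd e hP hQ, ← mul_assoc]
  refine (real_inner_le_norm _ _).trans (mul_le_mul_of_nonneg_right ?_ (norm_nonneg _))
  refine le_of_sq_le_sq ?_ (by positivity)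
  rw [mul_pow, Real.sq_sqrt (coefSq_pos hd n).le]
  exact norm_sph_raise_sq_le hd he n P hP

theorem inner_mulLin_eq_zero (hd : 2 ≤ d) (e : Fin d → ℝ) {n m : ℕ} (h1 : m ≠ n + 1)
    (h2 : n ≠ m + 1) {f g : L2 d} (hf : f ∈ harmonics d n) (hg : g ∈ harmonics d m) :
    inner ℝ (mulLin e f) g = 0 := by
  obtain ⟨P, hP, rfl⟩ := hf
  change inner ℝ (mulLin e (sph d P)) g = 0
  rw [mulLin_sph, sph_linForm_mul e n, inner_add_left,
    inner_eq_zero_of_mem_harmonics (by omega) h1.symm (sph_mem_harmonics (raise_mem_solid hd hP)) hg,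
    zero_add]
  rcases Nat.eq_zero_or_pos n with rfl | hn
  · rw [lower_zero_of_isHomogeneous (mem_solid.1 hP).1, map_zero, inner_zero_left]
  · exact inner_eq_zero_of_mem_harmonics (by omega) (by omega)
      (sph_mem_harmonics (lower_mem_solid hP)) hg

/-- The solid zonal harmonics with axis `e`. -/
noncomputable def zonal (e : Fin d → ℝ) : ℕ → MvPolynomial (Fin d) ℝ
  | 0 => 1
  | n + 1 => raise e n (zonal e n)

theorem zonal_succ (e : Fin d → ℝ) (n : ℕ) : zonal e (n + 1) = raise e n (zonal e n) := rfl

theorem zonal_mem_solid (hd : 2 ≤ d) (e : Fin d → ℝ) (n : ℕ) : zonal e n ∈ solid d n := by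
  induction n with
  | zero => exact C_mem_solid 1
  | succ n ih => exact raise_mem_solid hd ih

/-- On zonal harmonics the recursion holds with equality, so the bound of `norm_sph_raise_sq_le` is
attained simultaneously in all degrees. -/
theorem lower_zonal (hd : 2 ≤ d) {e : Fin d → ℝ} (he : ∑ i, e i ^ 2 = 1) (n : ℕ) :
    lower e (n + 1) (zonal e (n + 1)) = C (coefSq d (n + 1)) * zonal e n := by
  induction n with
  | zero =>
    have h := mem_solid.1 (zonal_mem_solid hd e 0)
    rw [zonal_succ, lower_raise hd he (zonal_mem_solid hd e 0), lower_zero_of_isHomogeneous h.1,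
      coefSq_succ]
    simp [raise, lower, coefSq]
  | succ n ih =>
    rw [zonal_succ, lower_raise hd he (zonal_mem_solid hd e (n + 1)), ih, Nat.add_sub_cancel]
    have e1 : raise e n (C (coefSq d (n + 1)) * zonal e n) =
        C (coefSq d (n + 1)) * zonal e (n + 1) := by
      rw [zonal_succ, raise, raise, lower, lower, ← smul_eq_C_mul, Derivation.map_smul, smul_eq_C_mul,
        smul_eq_C_mul]
      ring
    rw [e1, coefSq_succ d (n + 1), div_eq_inv_mul, C_mul, C_add, C_mul, C_1]
    ring

theorem inner_mulLin_zonal (hd : 2 ≤ d) (e : Fin d → ℝ) (n : ℕ) :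
    inner ℝ (mulLin e (sph d (zonal e n))) (sph d (zonal e (n + 1))) =
      ‖sph d (zonal e (n + 1))‖ ^ 2 := by
  rw [inner_sph_raise hd e (zonal_mem_solid hd e n) (zonal_mem_solid hd e (n + 1)), zonal_succ,
    real_inner_self_eq_norm_sq]

theorem norm_sph_zonal_succ_sq (hd : 2 ≤ d) {e : Fin d → ℝ} (he : ∑ i, e i ^ 2 = 1) (n : ℕ) :
    ‖sph d (zonal e (n + 1))‖ ^ 2 = coefSq d (n + 1) * ‖sph d (zonal e n)‖ ^ 2 := by
  rw [← inner_mulLin_zonal hd, inner_sph_lower hd e (zonal_mem_solid hd e n)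
    (zonal_mem_solid hd e (n + 1)), lower_zonal hd he, sph_C_mul, inner_smul_right,
    real_inner_self_eq_norm_sq]

theorem norm_sph_zonal_pos (hd : 2 ≤ d) {e : Fin d → ℝ} (he : ∑ i, e i ^ 2 = 1) (n : ℕ) :
    0 < ‖sph d (zonal e n)‖ := by
  induction n with
  | zero =>
    rw [norm_pos_iff]
    intro h
    have h1 : inner ℝ (sph d (zonal e 0)) (sph d (zonal e 0)) = 0 := by rw [h, inner_zero_left]
    rw [inner_sph_sph, zonal, mul_one, restrict_one] at h1
    have : Nonempty (Fin d) := ⟨⟨0, by omega⟩⟩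
    have h2 : (surf d).real Set.univ = 0 := by simpa using h1
    exact Measure.toSphere_ne_zero _ (Measure.measure_univ_eq_zero.1
      ((measureReal_eq_zero_iff (measure_ne_top _ _)).1 h2))
  | succ n ih =>
    have h := norm_sph_zonal_succ_sq hd he n
    have h1 := mul_pos (coefSq_pos hd n) (pow_pos ih 2)
    rw [← h] at h1
    exact (norm_nonneg _).lt_of_ne' fun h0 => by simp [h0] at h1

/-! ### Expansion in spherical harmonics -/

theorem proj_mem (n : ℕ) (f : L2 d) : proj d n f ∈ harmonics d n :=
  Submodule.starProjection_apply_mem _ _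

theorem proj_of_mem {n : ℕ} {f : L2 d} (hf : f ∈ harmonics d n) : proj d n f = f :=
  Submodule.starProjection_eq_self_iff.2 hf

theorem proj_of_mem_of_ne (hd : 1 ≤ d) {n m : ℕ} (hnm : n ≠ m) {f : L2 d}
    (hf : f ∈ harmonics d m) : proj d n f = 0 := by
  refine (Submodule.starProjection_apply_eq_zero_iff _).2 ?_
  exact fun g hg => inner_eq_zero_of_mem_harmonics hd hnm hg hf

theorem hasSum_proj (hd : 2 ≤ d) (f : L2 d) : HasSum (fun n => proj d n f) f := by
  have hV := IsHilbertSum.mkInternal (harmonics d) (orthogonalFamily_harmonics (d := d) (by omega))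
    (dense_harmonics hd)
  have h := hV.hasSum_linearIsometryEquiv_symm (hV.linearIsometryEquiv f)
  rw [LinearIsometryEquiv.symm_apply_apply] at h
  set w := hV.linearIsometryEquiv f
  -- `proj d n` kills every component of the Hilbert sum except the one of degree `n`.
  have hp : ∀ n, proj d n f = w n := by
    intro n
    have h1 := h.mapL (proj d n)
    have h2 : HasSum (fun i => proj d n ((harmonics d i).subtypeₗᵢ (w i))) (w n : L2 d) := by
      have h3 : proj d n ((harmonics d n).subtypeₗᵢ (w n)) = (w n : L2 d) :=
        proj_of_mem (w n).2
      rw [← h3]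
      exact hasSum_single n fun i hi => proj_of_mem_of_ne (by omega) hi.symm (w i).2
    exact h1.unique h2
  rw [show (fun n => proj d n f) = fun n => (w n : L2 d) from funext hp]
  exact h

theorem eq_of_proj_eq (hd : 2 ≤ d) {f g : L2 d} (h : ∀ n, proj d n f = proj d n g) : f = g := by
  have h1 := hasSum_proj hd f
  simp only [h] at h1
  exact h1.unique (hasSum_proj hd g)

theorem norm_sum_sq_of_mem_harmonics (hd : 1 ≤ d) {g : ℕ → L2 d} (hg : ∀ n, g n ∈ harmonics d n)
    (s : Finset ℕ) : ‖∑ n ∈ s, g n‖ ^ 2 = ∑ n ∈ s, ‖g n‖ ^ 2 :=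
  (orthogonalFamily_harmonics hd).norm_sum (fun n => ⟨g n, hg n⟩) s

theorem IsFracLaplacian.unique (hd : 2 ≤ d) {r : ℝ} {f g g' : L2 d}
    (hg : IsFracLaplacian d r f g) (hg' : IsFracLaplacian d r f g') : g = g' := by
  refine eq_of_proj_eq hd fun n => ?_
  rcases Nat.eq_zero_or_pos n with rfl | hn
  · rw [hg.1, hg'.1]
  · rw [hg.2 n hn, hg'.2 n hn]

theorem fracLaplacian_eq (hd : 2 ≤ d) {r : ℝ} {f g : L2 d} (hg : IsFracLaplacian d r f g) :
    fracLaplacian d r f = g := by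
  have h : ∃ g, IsFracLaplacian d r f g := ⟨g, hg⟩
  rw [fracLaplacian, dif_pos h]
  exact h.choose_spec.unique hd hg

/-! ### The weighted energy as a quadratic form -/

theorem integral_abs_sq (f : L2 d) : ∫ x, |f x| ^ 2 ∂surf d = ‖f‖ ^ 2 := by
  rw [← real_inner_self_eq_norm_sq, L2.inner_def]
  refine integral_congr_ae (Eventually.of_forall fun x => ?_)
  simp [pow_two]

theorem weightedEnergy_eq (g : L2 d) (e : Sph d) :
    weightedEnergy d g e = ‖g‖ ^ 2 - inner ℝ (mulLin (e : Euc d) g) g := by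
  have h1 : Integrable (fun x => |g x| ^ 2) (surf d) := by
    simpa using (Lp.memLp g).integrable_sq
  have h2 : Integrable (fun x => restrict d (linForm (e : Euc d)) x * (g x * g x)) (surf d) := by
    have := L2.integrable_inner (𝕜 := ℝ) (mulLin (e : Euc d) g) g
    refine this.congr ?_
    filter_upwards [coeFn_mulLin (e : Euc d) g] with x hx
    rw [hx]
    simp
    ring
  rw [← integral_abs_sq, inner_mulLin, ← integral_sub h1 h2, weightedEnergy]
  refine integral_congr_ae (Eventually.of_forall fun x => ?_)
  simp only [restrict_linForm, sq_abs]
  ring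

theorem sum_sq_of_sphere (e : Sph d) : ∑ i, (e : Euc d) i ^ 2 = 1 := by
  have h : ‖(e : Euc d)‖ ^ 2 = 1 := by simp
  rwa [EuclideanSpace.real_norm_sq_eq] at h

/-- The form is tridiagonal with zero diagonal; the factor `2` comes from its symmetry. -/
theorem inner_mulLin_sum (hd : 2 ≤ d) (e : Fin d → ℝ) {g : ℕ → L2 d}
    (hg : ∀ n, g n ∈ harmonics d n) (N : ℕ) :
    inner ℝ (mulLin e (∑ n ∈ Finset.range (N + 1), g n)) (∑ n ∈ Finset.range (N + 1), g n) =
      2 * ∑ n ∈ Finset.range N, inner ℝ (mulLin e (g n)) (g (n + 1)) := by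
  induction N with
  | zero => simpa using inner_mulLin_eq_zero hd e (by omega) (by omega) (hg 0) (hg 0)
  | succ N ih =>
    have h1 : inner ℝ (mulLin e (∑ n ∈ Finset.range (N + 1), g n)) (g (N + 1)) =
        inner ℝ (mulLin e (g N)) (g (N + 1)) := by
      rw [map_sum, sum_inner, Finset.sum_range_succ, Finset.sum_eq_zero, zero_add]
      intro n hn
      rw [Finset.mem_range] at hn
      exact inner_mulLin_eq_zero hd e (by omega) (by omega) (hg n) (hg (N + 1))
    have h2 : inner ℝ (mulLin e (g (N + 1))) (g (N + 1)) = 0 :=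
      inner_mulLin_eq_zero hd e (by omega) (by omega) (hg _) (hg _)
    rw [Finset.sum_range_succ _ (N + 1), map_add, inner_add_left, inner_add_right, inner_add_right,
      ih, h2, inner_mulLin_comm e (g (N + 1)), h1, Finset.sum_range_succ _ N]
    ring

/-! ### A discrete Hardy inequality -/

theorem sqrt_one_sub_add_sqrt_one_add_le {x : ℝ} (h0 : 0 ≤ x) (h1 : x ≤ 1) :
    √(1 - x) + √(1 + x) ≤ 2 - x ^ 2 / 4 := by
  refine le_of_sq_le_sq ?_ (by nlinarith)
  have e1 := Real.sq_sqrt (by linarith : 0 ≤ 1 - x)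
  have e2 := Real.sq_sqrt (by linarith : 0 ≤ 1 + x)
  have e3 : √(1 - x) * √(1 + x) ≤ 1 - x ^ 2 / 2 := by
    refine le_of_sq_le_sq ?_ (by nlinarith)
    rw [mul_pow, e1, e2]
    nlinarith [sq_nonneg (x ^ 2)]
  nlinarith [sq_nonneg (x ^ 2)]

/-- Weighted AM–GM with weights `√((n+1)/n)` and `√(n/(n+1))`, whose product is `1`. Equality holds
for `u_n = √n`. The resulting coefficient of `u_n²` is `(√(1+1/n) + √(1-1/n))/2 ≤ 1 - 1/(8n²)`. -/
theorem sum_mul_succ_le (u : ℕ → ℝ) (hu : u 0 = 0) (N : ℕ) :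
    ∑ n ∈ Finset.range N, u n * u (n + 1) ≤
      ∑ n ∈ Finset.range (N + 1), (1 - 1 / (8 * (n : ℝ) ^ 2)) * u n ^ 2 := by
  -- The added term is the share of `u N ^ 2` reserved for the next product. At `N = 0` it vanishes
  -- because `u 0 = 0`.
  suffices h : ∑ n ∈ Finset.range N, u n * u (n + 1) + 1 / 2 * √(1 + 1 / N) * u N ^ 2 ≤
      ∑ n ∈ Finset.range (N + 1), (1 - 1 / (8 * (n : ℝ) ^ 2)) * u n ^ 2 by
    have : 0 ≤ 1 / 2 * √(1 + 1 / (N : ℝ)) * u N ^ 2 := by positivity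
    linarith
  induction N with
  | zero => simp [hu]
  | succ N ih =>
    rw [Finset.sum_range_succ, Finset.sum_range_succ _ (N + 1)]
    have hN : (0 : ℝ) < ((N + 1 : ℕ) : ℝ) := by positivity
    have hN1 : (1 : ℝ) ≤ ((N + 1 : ℕ) : ℝ) := by exact_mod_cast Nat.succ_le_succ (Nat.zero_le N)
    have hx0 : 0 ≤ 1 / ((N + 1 : ℕ) : ℝ) := by positivity
    have hx1 : 1 / ((N + 1 : ℕ) : ℝ) ≤ 1 := (div_le_one hN).2 hN1
    have h1 := sqrt_one_sub_add_sqrt_one_add_le hx0 hx1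
    have h2 : u N * u (N + 1) ≤ 1 / 2 * √(1 + 1 / N) * u N ^ 2 +
        1 / 2 * √(1 - 1 / ((N + 1 : ℕ) : ℝ)) * u (N + 1) ^ 2 := by
      rcases Nat.eq_zero_or_pos N with rfl | hpos
      · rw [hu]
        simp
      · have hp : (0 : ℝ) < N := by exact_mod_cast hpos
        have h3 : √(1 + 1 / (N : ℝ)) * √(1 - 1 / ((N + 1 : ℕ) : ℝ)) = 1 := by
          rw [← Real.sqrt_mul (by positivity), Real.sqrt_eq_one]
          push_cast
          field_simp
          ring
        set a := √(1 + 1 / (N : ℝ))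
        set b := √(1 - 1 / ((N + 1 : ℕ) : ℝ))
        have ha : 0 < a := Real.sqrt_pos.2 (by positivity)
        have h4 : 0 ≤ a * (u N - b * u (N + 1)) ^ 2 := by positivity
        have h5 : a * (u N - b * u (N + 1)) ^ 2 =
            a * u N ^ 2 - 2 * (a * b) * (u N * u (N + 1)) + (a * b) * b * u (N + 1) ^ 2 := by ring
        rw [h5, h3] at h4
        linarith
    have h6 : 1 / 2 * (√(1 - 1 / ((N + 1 : ℕ) : ℝ)) + √(1 + 1 / ((N + 1 : ℕ) : ℝ))) *
        u (N + 1) ^ 2 ≤ (1 - 1 / (8 * ((N + 1 : ℕ) : ℝ) ^ 2)) * u (N + 1) ^ 2 := by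
      refine mul_le_mul_of_nonneg_right ?_ (sq_nonneg _)
      have e : (1 / ((N + 1 : ℕ) : ℝ)) ^ 2 / 4 = 2 * (1 / (8 * ((N + 1 : ℕ) : ℝ) ^ 2)) := by
        field_simp
        ring
      rw [e] at h1
      linarith
    linarith

/-! ### The inequality -/

theorem two_mul_sqrt_coefSq (hd : 2 ≤ d) {n : ℕ} (hn : 1 ≤ n) :
    2 * √(coefSq d (n + 1)) =
      alpha (((d : ℝ) - 2) / 2) n * alpha (((d : ℝ) - 2) / 2) (n + 1) := by
  have hd' : (2 : ℝ) ≤ d := by exact_mod_cast hd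
  have hl : 0 ≤ ((d : ℝ) - 2) / 2 := by linarith
  have h1 := alpha_pos hl hn
  have h2 := alpha_pos hl (by omega : 1 ≤ n + 1)
  have h := alpha_mul_alpha_succ_sq hd hn
  rw [← Real.sqrt_sq (by positivity : (0 : ℝ) ≤ alpha (((d : ℝ) - 2) / 2) n * _), h,
    Real.sqrt_mul (by norm_num), show (4 : ℝ) = 2 ^ 2 by norm_num, Real.sqrt_sq (by norm_num)]

/-- The Hardy inequality is applied to `α_n ‖g_n‖`. The condition `g 0 = 0` removes the block from
degree `0` to `1`, which the identity with `α` does not cover. -/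
theorem sum_beta_mul_le (hd : 2 ≤ d) {e : Fin d → ℝ} (he : ∑ i, e i ^ 2 = 1) {g : ℕ → L2 d}
    (hg : ∀ n, g n ∈ harmonics d n) (h0 : g 0 = 0) {c : ℕ → ℝ}
    (hc : ∀ n, 1 ≤ n → ‖g n‖ ^ 2 = (n : ℝ) * (n + d - 2) * c n) (N : ℕ) :
    ∑ n ∈ Finset.range N, beta (((d : ℝ) - 2) / 2) (n + 1) * c (n + 1) ≤
      ‖∑ n ∈ Finset.range (N + 1), g n‖ ^ 2 -
        inner ℝ (mulLin e (∑ n ∈ Finset.range (N + 1), g n))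
          (∑ n ∈ Finset.range (N + 1), g n) := by
  set lam := ((d : ℝ) - 2) / 2 with hlam
  have hardy := sum_mul_succ_le (fun n => alpha lam n * ‖g n‖) (by simp [h0]) N
  have h1 : 2 * ∑ n ∈ Finset.range N, inner ℝ (mulLin e (g n)) (g (n + 1)) ≤
      ∑ n ∈ Finset.range N, alpha lam n * ‖g n‖ * (alpha lam (n + 1) * ‖g (n + 1)‖) := by
    rw [Finset.mul_sum]
    refine Finset.sum_le_sum fun n _ => ?_
    rcases Nat.eq_zero_or_pos n with rfl | hn
    · simp [h0]
    · have h2 := inner_mulLin_le hd he (hg n) (hg (n + 1))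
      have h3 := two_mul_sqrt_coefSq hd hn
      calc _ ≤ 2 * (√(coefSq d (n + 1)) * (‖g n‖ * ‖g (n + 1)‖)) := by linarith
        _ = 2 * √(coefSq d (n + 1)) * (‖g n‖ * ‖g (n + 1)‖) := by ring
        _ = _ := by rw [h3]; ring
  rw [inner_mulLin_sum hd e hg, norm_sum_sq_of_mem_harmonics (by omega) hg]
  have h4 : ∑ n ∈ Finset.range N, beta lam (n + 1) * c (n + 1) =
      ∑ n ∈ Finset.range (N + 1), ‖g n‖ ^ 2 -
        ∑ n ∈ Finset.range (N + 1), (1 - 1 / (8 * (n : ℝ) ^ 2)) * (alpha lam n * ‖g n‖) ^ 2 := by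
    rw [← Finset.sum_sub_distrib, Finset.sum_range_succ']
    simp only [h0, norm_zero]
    rw [zero_pow two_ne_zero, mul_zero, zero_pow two_ne_zero, mul_zero, sub_zero, add_zero]
    refine Finset.sum_congr rfl fun n _ => ?_
    rw [mul_pow, hc (n + 1) (by omega), beta]
    have e1 : ((n + 1 : ℕ) : ℝ) + 2 * lam = ((n + 1 : ℕ) : ℝ) + d - 2 := by rw [hlam]; ring
    rw [e1]
    ring
  linarith

theorem proj_eq_zero_of_mem_orthPoly {k n : ℕ} (hn : n ≤ k) {f : L2 d} (hf : f ∈ orthPoly d k) :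
    proj d n f = 0 := by
  refine (Submodule.starProjection_apply_eq_zero_iff _).2 ?_
  rintro _ ⟨P, hP, rfl⟩
  rw [real_inner_comm]
  exact (inner_sph_right f P).trans (hf P (((mem_solid.1 hP).1.totalDegree_le).trans hn))

/-- The estimate is proved for partial sums; both sides are continuous in `L²`, so it passes to the
limit. -/
theorem betaInf_mul_norm_sq_le (hd : 2 ≤ d) {k : ℕ}
    (hk : ∀ n, k < n → betaInf (((d : ℝ) - 2) / 2) ≤ beta (((d : ℝ) - 2) / 2) n)
    {f g : L2 d} (hf : f ∈ orthPoly d k) (hg : IsFracLaplacian d (1 / 2) f g) (e : Sph d) :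
    betaInf (((d : ℝ) - 2) / 2) * ‖f‖ ^ 2 ≤ weightedEnergy d g e := by
  have hd' : (2 : ℝ) ≤ d := by exact_mod_cast hd
  set lam := ((d : ℝ) - 2) / 2
  have hN : ∀ N, betaInf lam * ‖∑ n ∈ Finset.range (N + 1), proj d n f‖ ^ 2 ≤
      ‖∑ n ∈ Finset.range (N + 1), proj d n g‖ ^ 2 -
        inner ℝ (mulLin (e : Euc d) (∑ n ∈ Finset.range (N + 1), proj d n g))
          (∑ n ∈ Finset.range (N + 1), proj d n g) := by
    intro N
    refine le_trans ?_ (sum_beta_mul_le hd (sum_sq_of_sphere e) (fun n => proj_mem n g) hg.1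
      (c := fun n => ‖proj d n f‖ ^ 2) ?_ N)
    · rw [norm_sum_sq_of_mem_harmonics (by omega) (fun n => proj_mem n f), Finset.sum_range_succ',
        proj_eq_zero_of_mem_orthPoly (Nat.zero_le k) hf, norm_zero, zero_pow two_ne_zero, add_zero,
        Finset.mul_sum]
      refine Finset.sum_le_sum fun n _ => ?_
      rcases le_or_gt (n + 1) k with h | h
      · rw [proj_eq_zero_of_mem_orthPoly h hf]
        simp
      · exact mul_le_mul_of_nonneg_right (hk _ h) (sq_nonneg _)
    · intro n hn
      have hn' : (1 : ℝ) ≤ n := by exact_mod_cast hn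
      have hb : 0 ≤ (n : ℝ) * (n + d - 2) := mul_nonneg (by linarith) (by linarith)
      rw [hg.2 n hn, norm_smul, mul_pow, ← Real.sqrt_eq_rpow, Real.norm_of_nonneg
        (Real.sqrt_nonneg _), Real.sq_sqrt hb]
  have tf : Tendsto (fun N => ∑ n ∈ Finset.range (N + 1), proj d n f) atTop (𝓝 f) :=
    (hasSum_proj hd f).tendsto_sum_nat.comp (tendsto_add_atTop_nat 1)
  have tg : Tendsto (fun N => ∑ n ∈ Finset.range (N + 1), proj d n g) atTop (𝓝 g) :=
    (hasSum_proj hd g).tendsto_sum_nat.comp (tendsto_add_atTop_nat 1)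
  rw [weightedEnergy_eq]
  exact le_of_tendsto_of_tendsto' ((tf.norm.pow 2).const_mul _)
    ((tg.norm.pow 2).sub ((((mulLin (e : Euc d)).continuous.tendsto g).comp tg).inner tg)) hN

theorem inequality_of_betaInf_le (hd : 2 ≤ d) {k : ℕ} (hpos : 0 < betaInf (((d : ℝ) - 2) / 2))
    (hk : ∀ n, k < n → betaInf (((d : ℝ) - 2) / 2) ≤ beta (((d : ℝ) - 2) / 2) n) :
    Inequality d k (betaInf (((d : ℝ) - 2) / 2))⁻¹ := by
  rintro f ⟨hf, g, hg⟩
  obtain ⟨e, he⟩ := (minWeightedEnergy_isLeast d (by omega) g).1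
  rw [fracLaplacian_eq hd hg, ← he, integral_abs_sq, inv_mul_eq_div, le_div_iff₀ hpos, mul_comm]
  exact betaInf_mul_norm_sq_le hd hk hf hg e

/-! ### Optimality of the constant in the discrete Hardy inequality -/

theorem sum_sq_sub_sum_mul_succ (u : ℕ → ℝ) (N : ℕ) :
    ∑ n ∈ Finset.range (N + 1), u n ^ 2 - ∑ n ∈ Finset.range N, u n * u (n + 1) =
      1 / 2 * ∑ n ∈ Finset.range N, (u (n + 1) - u n) ^ 2 + 1 / 2 * u N ^ 2 + 1 / 2 * u 0 ^ 2 := by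
  induction N with
  | zero => simp; ring
  | succ N ih =>
    rw [Finset.sum_range_succ _ (N + 1), Finset.sum_range_succ (fun n => u n * u (n + 1)) N,
      Finset.sum_range_succ (fun n => (u (n + 1) - u n) ^ 2) N]
    linarith

/-- The square root, cut off to `0` below `K` and decreasing linearly to `0` on `[N, 2 N]`. -/
noncomputable def cutoffSqrt (K N n : ℕ) : ℝ :=
  if n < K then 0 else if n ≤ N then √n else (2 * N - n) / √N

/-- The jump at `K` costs `(√K)²`, each step of the square root at most `1/(4n)`, and the `N` linear
steps of size `1/√N` cost `1` in total. -/
theorem sum_cutoffSqrt_sub_sq_le {K N : ℕ} (hK : 1 ≤ K) (hKN : K ≤ N) :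
    ∑ n ∈ Finset.range (2 * N), (cutoffSqrt K N (n + 1) - cutoffSqrt K N n) ^ 2 ≤
      K + 1 / 4 * ∑ n ∈ Finset.Ico K N, 1 / (n : ℝ) + 1 := by
  have hN : (0 : ℝ) < N := by exact_mod_cast hK.trans hKN
  have hsN : 0 < √(N : ℝ) := Real.sqrt_pos.2 hN
  rw [← Finset.sum_range_add_sum_Ico _ (by omega : N ≤ 2 * N),
    ← Finset.sum_range_add_sum_Ico _ hKN]
  refine add_le_add (add_le_add ?_ ?_) ?_
  · obtain ⟨k, rfl⟩ : ∃ k, K = k + 1 := ⟨K - 1, by omega⟩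
    rw [Finset.sum_range_succ, Finset.sum_eq_zero, zero_add]
    · rw [cutoffSqrt, cutoffSqrt, if_neg (lt_irrefl _), if_pos hKN, if_pos (Nat.lt_succ_self k),
        sub_zero, Real.sq_sqrt (Nat.cast_nonneg _)]
    · intro n hn
      rw [Finset.mem_range] at hn
      rw [cutoffSqrt, cutoffSqrt, if_pos (by omega), if_pos (by omega)]
      simp
  · rw [Finset.mul_sum]
    refine Finset.sum_le_sum fun n hn => ?_
    rw [Finset.mem_Ico] at hn
    have hn0 : (0 : ℝ) < n := by exact_mod_cast hK.trans hn.1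
    rw [cutoffSqrt, cutoffSqrt, if_neg (by omega), if_pos (by omega), if_neg (by omega),
      if_pos (by omega)]
    have e1 := Real.sq_sqrt hn0.le
    have e2 := Real.sq_sqrt (by positivity : (0 : ℝ) ≤ ((n + 1 : ℕ) : ℝ))
    have h1 : √(n : ℝ) ≤ √((n + 1 : ℕ) : ℝ) := Real.sqrt_le_sqrt (by push_cast; linarith)
    set a := √(n : ℝ)
    set b := √((n + 1 : ℕ) : ℝ)
    have ha : 0 < a := Real.sqrt_pos.2 hn0
    push_cast at e2
    have h2 : (b - a) * (b + a) = 1 := by nlinarith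
    have h3 : (b - a) * (2 * a) ≤ 1 := by nlinarith
    have h4 : ((b - a) * (2 * a)) ^ 2 ≤ 1 := by
      have : 0 ≤ (b - a) * (2 * a) := mul_nonneg (by linarith) (by linarith)
      nlinarith
    have h5 : (b - a) ^ 2 * (4 * n) ≤ 1 := by
      have e : ((b - a) * (2 * a)) ^ 2 = (b - a) ^ 2 * (4 * a ^ 2) := by ring
      rwa [e, e1] at h4
    rw [one_div_mul_one_div, le_div_iff₀ (by positivity)]
    exact h5
  · have h1 : ∀ n ∈ Finset.Ico N (2 * N),
        (cutoffSqrt K N (n + 1) - cutoffSqrt K N n) ^ 2 = 1 / N := by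
      intro n hn
      rw [Finset.mem_Ico] at hn
      have e1 : cutoffSqrt K N n = (2 * N - n) / √N := by
        rw [cutoffSqrt, if_neg (by omega)]
        split_ifs with h
        · obtain rfl : n = N := by omega
          rw [eq_div_iff hsN.ne', Real.mul_self_sqrt hN.le]
          ring
        · rfl
      rw [e1, cutoffSqrt, if_neg (by omega), if_neg (by omega), ← sub_div, div_pow,
        Real.sq_sqrt hN.le]
      push_cast
      ring
    rw [Finset.sum_congr rfl h1, Finset.sum_const, Nat.card_Ico, nsmul_eq_mul]
    have : 2 * N - N = N := by omega
    rw [this, mul_one_div_cancel hN.ne']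

theorem tendsto_sum_Ico_one_div (K : ℕ) :
    Tendsto (fun N : ℕ => ∑ n ∈ Finset.Ico K N, 1 / (n : ℝ)) atTop atTop := by
  have h := (not_summable_iff_tendsto_nat_atTop_of_nonneg
    (f := fun n : ℕ => 1 / (n : ℝ)) (fun n => by positivity)).1 Real.not_summable_one_div_natCast
  refine (tendsto_atTop_add_const_right _ (-∑ n ∈ Finset.range K, 1 / (n : ℝ)) h).congr' ?_
  filter_upwards [eventually_ge_atTop K] with N hN
  rw [← Finset.sum_range_add_sum_Ico _ hN]
  ring

/-- On `cutoffSqrt` the form `∑ u_n² - ∑ u_n u_{n+1}` is at most an eighth of the harmonic sum plus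
a constant. If `C(Q + 1/8) < 1`, the terms `(p_n - C q_n) u_n²` exceed `C/8` times the harmonic sum
by a positive multiple of it, which is impossible since that sum diverges. -/
theorem one_le_of_discrete_inequality {p q : ℕ → ℝ} {Q C : ℝ} (hC : 0 < C) {k : ℕ}
    (hp : Tendsto (fun n : ℕ => p n * (n : ℝ) ^ 2) atTop (𝓝 1))
    (hq : Tendsto (fun n : ℕ => q n * (n : ℝ) ^ 2) atTop (𝓝 Q))
    (h : ∀ (u : ℕ → ℝ) (N : ℕ), (∀ n ≤ k, u n = 0) →
      ∑ n ∈ Finset.range (N + 1), p n * u n ^ 2 ≤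
        C * (∑ n ∈ Finset.range (N + 1), (q n + 1) * u n ^ 2 -
          ∑ n ∈ Finset.range N, u n * u (n + 1))) :
    1 ≤ C * (Q + 1 / 8) := by
  by_contra! hcon
  obtain ⟨η, hη, hη'⟩ : ∃ η, 0 < η ∧ C / 8 + η < 1 - C * Q :=
    ⟨(1 - C * (Q + 1 / 8)) / 2, by linarith, by linarith⟩
  have hw : ∀ᶠ n : ℕ in atTop, C / 8 + η < p n * (n : ℝ) ^ 2 - C * (q n * (n : ℝ) ^ 2) :=
    (hp.sub (hq.const_mul C)).eventually_const_lt hη'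
  obtain ⟨K₀, hK₀⟩ := eventually_atTop.1 hw
  -- Beyond `K₀` the asymptotic lower bound holds; beyond `k` the test sequence is allowed to be
  -- nonzero.
  set K := max K₀ (k + 1)
  have hK1 : 1 ≤ K := le_max_of_le_right (by omega)
  have hbound : ∀ N, K ≤ N → η * ∑ n ∈ Finset.Ico K N, 1 / (n : ℝ) ≤ C / 2 * (K + 1) := by
    intro N hKN
    have hu0 : ∀ n, n < K → cutoffSqrt K N n = 0 := fun n hn => if_pos hn
    have h1 := h (cutoffSqrt K N) (2 * N) fun n hn =>
      hu0 n (lt_of_lt_of_le (Nat.lt_succ_of_le hn) (le_max_right _ _))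
    have h2 := sum_sq_sub_sum_mul_succ (cutoffSqrt K N) (2 * N)
    have h3 := sum_cutoffSqrt_sub_sq_le hK1 hKN
    have hu2N : cutoffSqrt K N (2 * N) = 0 := by
      rw [cutoffSqrt, if_neg (by omega), if_neg (by omega)]
      simp
    rw [hu2N, hu0 0 (by omega)] at h2
    have h4 : ∑ n ∈ Finset.range (2 * N + 1), (p n - C * q n) * cutoffSqrt K N n ^ 2 ≤
        C / 2 * (K + 1 / 4 * ∑ n ∈ Finset.Ico K N, 1 / (n : ℝ) + 1) := by
      have e1 : ∑ n ∈ Finset.range (2 * N + 1), (p n - C * q n) * cutoffSqrt K N n ^ 2 =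
          ∑ n ∈ Finset.range (2 * N + 1), p n * cutoffSqrt K N n ^ 2 -
            C * ∑ n ∈ Finset.range (2 * N + 1), q n * cutoffSqrt K N n ^ 2 := by
        rw [Finset.mul_sum, ← Finset.sum_sub_distrib]
        exact Finset.sum_congr rfl fun n _ => by ring
      simp only [add_mul, one_mul, Finset.sum_add_distrib] at h1
      have h5 := mul_le_mul_of_nonneg_left h3 hC.le
      rw [e1]
      nlinarith
    have h6 : ∑ n ∈ Finset.Ico K N, (C / 8 + η) * (1 / (n : ℝ)) ≤
        ∑ n ∈ Finset.range (2 * N + 1), (p n - C * q n) * cutoffSqrt K N n ^ 2 := by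
      have hlow : ∀ n, K ≤ n → 0 < (n : ℝ) ∧ (C / 8 + η) * (1 / (n : ℝ) ^ 2) ≤ p n - C * q n := by
        intro n hn
        have hn0 : (0 : ℝ) < n := by exact_mod_cast hK1.trans hn
        refine ⟨hn0, ?_⟩
        rw [mul_one_div, div_le_iff₀ (by positivity)]
        have := hK₀ n ((le_max_left _ _).trans hn)
        linarith
      calc ∑ n ∈ Finset.Ico K N, (C / 8 + η) * (1 / (n : ℝ)) ≤
          ∑ n ∈ Finset.Ico K N, (p n - C * q n) * cutoffSqrt K N n ^ 2 := by
            refine Finset.sum_le_sum fun n hn => ?_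
            rw [Finset.mem_Ico] at hn
            obtain ⟨hn0, hl⟩ := hlow n hn.1
            rw [cutoffSqrt, if_neg (by omega), if_pos (by omega), Real.sq_sqrt hn0.le]
            refine le_trans (le_of_eq ?_) (mul_le_mul_of_nonneg_right hl hn0.le)
            field_simp
        -- The terms added are zero below `K` and nonnegative from `N` on, so the linear part of the
        -- cutoff only helps.
        _ ≤ _ := by
            refine Finset.sum_le_sum_of_subset_of_nonneg ?_ ?_
            · intro n hn
              rw [Finset.mem_Ico] at hn
              rw [Finset.mem_range]
              omega
            · intro n _ _
              rcases lt_or_ge n K with hn | hn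
              · rw [hu0 n hn]
                simp
              · obtain ⟨hn0, hl⟩ := hlow n hn
                exact mul_nonneg (le_trans (by positivity) hl) (sq_nonneg _)
    rw [← Finset.mul_sum] at h6
    linarith
  obtain ⟨N, hN1, hN2⟩ := ((eventually_ge_atTop K).and
    ((tendsto_sum_Ico_one_div K).eventually_gt_atTop (C / 2 * (K + 1) / η))).exists
  have h1 := hbound N hN1
  rw [div_lt_iff₀ hη] at hN2
  linarith

/-! ### Optimality on the sphere -/

/-- The normalized zonal harmonic of degree `n` with axis `e`. -/
noncomputable def zonalUnit (e : Fin d → ℝ) (n : ℕ) : L2 d :=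
  ‖sph d (zonal e n)‖⁻¹ • sph d (zonal e n)

theorem smul_zonalUnit_mem (hd : 2 ≤ d) (e : Fin d → ℝ) (a : ℝ) (n : ℕ) :
    a • zonalUnit e n ∈ harmonics d n :=
  Submodule.smul_mem _ _ (Submodule.smul_mem _ _ (sph_mem_harmonics (zonal_mem_solid hd e n)))

theorem norm_zonalUnit (hd : 2 ≤ d) {e : Fin d → ℝ} (he : ∑ i, e i ^ 2 = 1) (n : ℕ) :
    ‖zonalUnit e n‖ = 1 := by
  rw [zonalUnit, norm_smul, norm_inv, norm_norm, inv_mul_cancel₀ (norm_sph_zonal_pos hd he n).ne']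

theorem inner_mulLin_zonalUnit (hd : 2 ≤ d) {e : Fin d → ℝ} (he : ∑ i, e i ^ 2 = 1) (n : ℕ) :
    inner ℝ (mulLin e (zonalUnit e n)) (zonalUnit e (n + 1)) = √(coefSq d (n + 1)) := by
  have h1 := norm_sph_zonal_pos hd he n
  have h2 := norm_sph_zonal_pos hd he (n + 1)
  have h3 := norm_sph_zonal_succ_sq hd he n
  rw [zonalUnit, zonalUnit, map_smul, real_inner_smul_left, real_inner_smul_right,
    inner_mulLin_zonal hd]
  set x := ‖sph d (zonal e n)‖
  set y := ‖sph d (zonal e (n + 1))‖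
  have h4 : coefSq d (n + 1) = (y / x) ^ 2 := by
    rw [div_pow, h3]
    field_simp
  rw [h4, Real.sqrt_sq (by positivity)]
  field_simp

theorem proj_sum_of_mem (hd : 1 ≤ d) {g : ℕ → L2 d} (hg : ∀ n, g n ∈ harmonics d n) (m N : ℕ) :
    proj d m (∑ n ∈ Finset.range N, g n) = if m < N then g m else 0 := by
  rw [map_sum]
  split_ifs with h
  · rw [Finset.sum_eq_single m, proj_of_mem (hg m)]
    · exact fun n _ hn => proj_of_mem_of_ne hd hn.symm (hg n)
    · exact fun h' => absurd (Finset.mem_range.2 h) h'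
  · refine Finset.sum_eq_zero fun n hn => proj_of_mem_of_ne hd ?_ (hg n)
    rw [Finset.mem_range] at hn
    omega

theorem sum_mem_orthPoly (hd : 2 ≤ d) {k : ℕ} {g : ℕ → L2 d} (hg : ∀ n, g n ∈ harmonics d n)
    (h0 : ∀ n ≤ k, g n = 0) (N : ℕ) : ∑ n ∈ Finset.range N, g n ∈ orthPoly d k := by
  intro P hP
  rw [← inner_sph_right]
  have h : harmonicsUpTo d k ≤ (Submodule.span ℝ {∑ n ∈ Finset.range N, g n})ᗮ := by
    refine iSup₂_le fun m hm f hf => ?_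
    rw [Submodule.mem_orthogonal_singleton_iff_inner_right, sum_inner]
    refine Finset.sum_eq_zero fun n _ => ?_
    rcases le_or_gt n k with hn | hn
    · rw [h0 n hn, inner_zero_left]
    · exact inner_eq_zero_of_mem_harmonics (by omega) (by omega) (hg n) hf
  exact Submodule.mem_orthogonal_singleton_iff_inner_right.1 (h (sph_mem_harmonicsUpTo hd hP))

theorem weightedEnergy_nonneg (g : L2 d) (e : Sph d) : 0 ≤ weightedEnergy d g e := by
  refine integral_nonneg fun x => mul_nonneg ?_ (sq_nonneg _)
  have h := real_inner_le_norm (x : Euc d) (e : Euc d)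
  have hx : ‖(x : Euc d)‖ = 1 := by simp
  have he : ‖(e : Euc d)‖ = 1 := by simp
  rw [hx, he, mul_one] at h
  linarith

/-- Taking `g_n = (u_n/α_n) z_n` with unit zonal `z_n` makes each off-diagonal term exactly `u_n
u_{n+1}`. The form `… - 1 + 1` matches `q n + 1` in `one_le_of_discrete_inequality`. -/
theorem exists_zonal_test (hd : 2 ≤ d) {k : ℕ} (e : Sph d) {u : ℕ → ℝ} (hu : ∀ n ≤ k, u n = 0)
    (N : ℕ) : ∃ f g : L2 d, f ∈ orthPoly d k ∧ IsFracLaplacian d (1 / 2) f g ∧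
      ‖f‖ ^ 2 = ∑ n ∈ Finset.range (N + 1),
        1 / (alpha (((d : ℝ) - 2) / 2) n ^ 2 * (n * (n + d - 2))) * u n ^ 2 ∧
      weightedEnergy d g e = ∑ n ∈ Finset.range (N + 1),
        (1 / alpha (((d : ℝ) - 2) / 2) n ^ 2 - 1 + 1) * u n ^ 2 -
          ∑ n ∈ Finset.range N, u n * u (n + 1) := by
  have hd' : (2 : ℝ) ≤ d := by exact_mod_cast hd
  set lam := ((d : ℝ) - 2) / 2 with hlam
  have hl : 0 ≤ lam := by linarith
  have he := sum_sq_of_sphere e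
  set z := zonalUnit (d := d) (e : Euc d)
  set F : ℕ → L2 d := fun n => (u n / (alpha lam n * √(n * (n + d - 2)))) • z n
  set G : ℕ → L2 d := fun n => (u n / alpha lam n) • z n
  have hF : ∀ n, F n ∈ harmonics d n := fun n => smul_zonalUnit_mem hd _ _ n
  have hG : ∀ n, G n ∈ harmonics d n := fun n => smul_zonalUnit_mem hd _ _ n
  have hu0 := hu 0 (Nat.zero_le k)
  have hb : ∀ n : ℕ, 1 ≤ n → 0 < (n : ℝ) * (n + d - 2) := fun n hn => by
    have hn' : (1 : ℝ) ≤ n := by exact_mod_cast hn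
    exact mul_pos (by linarith) (by linarith)
  refine ⟨∑ n ∈ Finset.range (N + 1), F n, ∑ n ∈ Finset.range (N + 1), G n, ?_, ⟨?_, ?_⟩, ?_, ?_⟩
  · exact sum_mem_orthPoly hd hF (fun n hn => by simp [F, hu n hn]) _
  · rw [proj_sum_of_mem (by omega) hG, if_pos (by omega)]
    simp [G, hu0]
  · intro n hn
    rw [proj_sum_of_mem (by omega) hF, proj_sum_of_mem (by omega) hG]
    split_ifs
    · have h1 := alpha_pos hl hn
      have h2 := Real.sqrt_pos.2 (hb n hn)
      simp only [F, G]
      rw [← Real.sqrt_eq_rpow, smul_smul]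
      congr 1
      field_simp
    · rw [smul_zero]
  · rw [norm_sum_sq_of_mem_harmonics (by omega) hF]
    refine Finset.sum_congr rfl fun n _ => ?_
    rcases Nat.eq_zero_or_pos n with rfl | hn
    · simp [F, hu0]
    · rw [norm_smul, norm_zonalUnit hd he, mul_one, Real.norm_eq_abs, sq_abs, div_pow, mul_pow,
        Real.sq_sqrt (hb n hn).le]
      ring
  · rw [weightedEnergy_eq, inner_mulLin_sum hd _ hG, norm_sum_sq_of_mem_harmonics (by omega) hG]
    congr 1
    · refine Finset.sum_congr rfl fun n _ => ?_
      rw [norm_smul, norm_zonalUnit hd he, mul_one, Real.norm_eq_abs, sq_abs, div_pow]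
      ring
    · rw [Finset.mul_sum]
      refine Finset.sum_congr rfl fun n _ => ?_
      rcases Nat.eq_zero_or_pos n with rfl | hn
      · simp [G, hu0]
      · have h1 := alpha_pos hl hn
        have h2 := alpha_pos hl (by omega : 1 ≤ n + 1)
        have h3 := two_mul_sqrt_coefSq hd hn
        rw [← hlam] at h3
        rw [map_smul, real_inner_smul_left, real_inner_smul_right, inner_mulLin_zonalUnit hd he]
        calc _ = u n / alpha lam n * (u (n + 1) / alpha lam (n + 1)) *
              (2 * √(coefSq d (n + 1))) := by ring
          _ = _ := by
            rw [h3]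
            field_simp

theorem Inequality.one_le_mul_betaInf (hd : 2 ≤ d) {k : ℕ} {C : ℝ} (hC : Inequality d k C) :
    0 < C ∧ 1 ≤ C * betaInf (((d : ℝ) - 2) / 2) := by
  have hd' : (2 : ℝ) ≤ d := by exact_mod_cast hd
  have hl : 0 ≤ ((d : ℝ) - 2) / 2 := by linarith
  have : Nonempty (Fin d) := ⟨⟨0, by omega⟩⟩
  obtain ⟨e⟩ : Nonempty (Sph d) := (NormedSpace.sphere_nonempty.mpr zero_le_one).to_subtype
  have hle : ∀ f g : L2 d, f ∈ orthPoly d k → IsFracLaplacian d (1 / 2) f g →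
      ‖f‖ ^ 2 ≤ C * minWeightedEnergy d g := by
    intro f g hf hg
    have := hC f ⟨hf, g, hg⟩
    rwa [fracLaplacian_eq hd hg, integral_abs_sq] at this
  -- Tested on a single zonal harmonic of degree `k + 1`: its norm is positive and its energy
  -- nonnegative.
  have hCpos : 0 < C := by
    obtain ⟨f, g, hf, hg, hfn, -⟩ := exists_zonal_test hd (k := k) e
      (u := fun n => if n = k + 1 then 1 else 0) (fun n hn => if_neg (by omega)) (k + 1)
    have h1 := hle f g hf hg
    obtain ⟨e', he'⟩ := (minWeightedEnergy_isLeast d (by omega) g).1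
    have h2 : 0 ≤ minWeightedEnergy d g := he' ▸ weightedEnergy_nonneg g e'
    have h3 : 0 < ‖f‖ ^ 2 := by
      rw [hfn, Finset.sum_eq_single (k + 1)]
      · have h4 := alpha_pos hl (by omega : 1 ≤ k + 1)
        have h5 : (0 : ℝ) < ((k + 1 : ℕ) : ℝ) + d - 2 := by
          push_cast
          linarith [(Nat.cast_nonneg k : (0 : ℝ) ≤ k)]
        rw [if_pos rfl]
        positivity
      · intro n _ hn
        simp [hn]
      · simp
    by_contra! hneg
    nlinarith
  refine ⟨hCpos, ?_⟩
  have hinv : Tendsto (fun n : ℕ => (alpha (((d : ℝ) - 2) / 2) n ^ 2)⁻¹) atTop (𝓝 1) := by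
    simpa using (tendsto_alpha_sq hl).inv₀ one_ne_zero
  have hrat : Tendsto (fun n : ℕ => (1 + ((d : ℝ) - 2) * ((n : ℝ))⁻¹)⁻¹) atTop (𝓝 1) := by
    simpa using (((tendsto_natCast_atTop_atTop (R := ℝ)).inv_tendsto_atTop.const_mul
      ((d : ℝ) - 2)).const_add 1).inv₀ (by norm_num)
  -- Here `Q = λ(λ-1)/2`, the limit of `(1 - α_n²) n²`, and `Q + 1/8 = (2λ-1)²/8` is `β_λ(∞)`.
  have key := one_le_of_discrete_inequality
    (p := fun n => 1 / (alpha (((d : ℝ) - 2) / 2) n ^ 2 * (n * (n + d - 2))))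
    (q := fun n => 1 / alpha (((d : ℝ) - 2) / 2) n ^ 2 - 1)
    (Q := ((d : ℝ) - 2) / 2 * (((d : ℝ) - 2) / 2 - 1) / 2) hCpos (k := k) ?_ ?_ ?_
  · rw [betaInf]
    refine key.trans (le_of_eq ?_)
    ring
  · have h := hinv.mul hrat
    rw [mul_one] at h
    refine h.congr' ?_
    filter_upwards [eventually_ge_atTop 1] with n hn
    have hn' : (1 : ℝ) ≤ n := by exact_mod_cast hn
    have h1 := alpha_pos hl hn
    have h2 : (0 : ℝ) < n + d - 2 := by linarith
    have h3 : 1 + ((d : ℝ) - 2) * (n : ℝ)⁻¹ = (n + d - 2) / n := by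
      field_simp
      ring
    rw [h3]
    field_simp
  · have h := (tendsto_one_sub_alpha_sq_mul hl).mul hinv
    rw [mul_one] at h
    refine h.congr' ?_
    filter_upwards [eventually_ge_atTop 1] with n hn
    have h1 := alpha_pos hl hn
    field_simp
  · intro u N hu
    obtain ⟨f, g, hf, hg, hfn, hgn⟩ := exists_zonal_test hd e hu N
    rw [← hfn, ← hgn]
    refine (hle f g hf hg).trans (mul_le_mul_of_nonneg_left ?_ hCpos.le)
    exact (minWeightedEnergy_isLeast d (by omega) g).2 ⟨e, rfl⟩

theorem isLeast_inequality (hd : 2 ≤ d) (hd3 : d ≠ 3) {k : ℕ}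
    (hk : k ∈ thresholds (((d : ℝ) - 2) / 2)) :
    IsLeast {C : ℝ | Inequality d k C} (8 / ((d : ℝ) - 3) ^ 2) := by
  have hd' : (2 : ℝ) ≤ d := by exact_mod_cast hd
  have hl : 0 ≤ ((d : ℝ) - 2) / 2 := by linarith
  have hne : (d : ℝ) - 3 ≠ 0 := sub_ne_zero.2 (by exact_mod_cast hd3)
  have hb : betaInf (((d : ℝ) - 2) / 2) = ((d : ℝ) - 3) ^ 2 / 8 := by
    rw [betaInf]
    ring
  have hpos : 0 < betaInf (((d : ℝ) - 2) / 2) := by rw [hb]; positivity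
  have e : 8 / ((d : ℝ) - 3) ^ 2 = (betaInf (((d : ℝ) - 2) / 2))⁻¹ := by rw [hb, inv_div]
  rw [e]
  constructor
  · exact inequality_of_betaInf_le hd hpos fun n hn =>
      (mem_thresholds_iff hl).1 hk n (by omega) hn.le
  · intro C hC
    rw [inv_eq_one_div, div_le_iff₀ hpos]
    exact (Inequality.one_le_mul_betaInf hd hC).2

theorem not_inequality_three (k : ℕ) (C : ℝ) : ¬ Inequality 3 k C := by
  intro h
  have h1 := (h.one_le_mul_betaInf (by norm_num)).2
  have h2 : betaInf ((((3 : ℕ) : ℝ) - 2) / 2) = 0 := by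
    rw [betaInf]
    norm_num
  rw [h2] at h1
  linarith

end HardyRellich

/-- In `ℕ` the infimum of the empty set is `0`, so nonemptiness of `thresholds` is stated
separately: it expresses that `n(d)` exists. For `d = 4, 5, 6` it is contained in (i). -/
theorem mainTheorem1 :
    -- (i)
    (∀ d : ℕ, 4 ≤ d →
      (HardyRellich.thresholds (((d : ℝ) - 2) / 2)).Nonempty ∧
      (HardyRellich.index d : ℝ) ≤ 3 * ((d : ℝ) - 2) ^ 3 / 16 ∧
      ∀ k : ℕ, HardyRellich.index d ≤ k →
        IsLeast {C : ℝ | HardyRellich.Inequality d k C} (8 / ((d : ℝ) - 3) ^ 2)) ∧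
    -- (ii)
    ((HardyRellich.thresholds 0).Nonempty ∧
      HardyRellich.index 2 = 0 ∧ HardyRellich.index 4 = 0 ∧ HardyRellich.index 5 = 0 ∧
      HardyRellich.index 6 = 4 ∧
      ∀ k : ℕ, HardyRellich.index 2 ≤ k →
        IsLeast {C : ℝ | HardyRellich.Inequality 2 k C} 8) ∧
    -- (iii)
    (∀ (k : ℕ) (C : ℝ), ¬ HardyRellich.Inequality 3 k C) := by
  refine ⟨fun d hd => ?_, ⟨⟨0, HardyRellich.zero_mem_thresholds_zero⟩, HardyRellich.index_two,
    HardyRellich.index_four, HardyRellich.index_five, HardyRellich.index_six, fun k _ => ?_⟩,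
    HardyRellich.not_inequality_three⟩
  · obtain ⟨h1, h2⟩ := HardyRellich.thresholds_nonempty_and_index_le hd
    have hd' : (4 : ℝ) ≤ d := by exact_mod_cast hd
    exact ⟨h1, h2, fun k hk => HardyRellich.isLeast_inequality (by omega) (by omega)
      (HardyRellich.thresholds_mono (by linarith) (Nat.sInf_mem h1) hk)⟩
  · have e : (((2 : ℕ) : ℝ) - 2) / 2 = 0 := by norm_num
    have h := HardyRellich.isLeast_inequality (d := 2) le_rfl (by norm_num) (k := k)
      (by rw [e]; exact HardyRellich.thresholds_mono le_rfl
            HardyRellich.zero_mem_thresholds_zero (Nat.zero_le k))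
    norm_num at h
    exact h
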